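/- Throughout, $\log$ is the base-2 logarithm and $\mathbb N_+=\{1,2,\dots\}$ is the alphabet. **Redundancy.** For a class $\Lambda$ of stationary memoryless sources on $\mathbb N_+$ and $n\ge 1$, let $\mathbb P_n=\mathbb P_1^{\otimes n}$ be the law of the first $n$ symbols of $\mathbb P\in\Lambda$. For a probability $Q_n$ on $\mathbb N_+^n$ put $R^+(Q_n,\Lambda_n)=\sup_{\mathbb P\in\Lambda}D(\mathbb P_n,Q_n)$, where $D$ is the Kullback–Leibler divergence in bits, and $R^+(\Lambda_n)=\inf_{Q_n}R^+(Q_n,\Lambda_n)$, the infimum being over all probabilities $Q_n$ on $\mathbb N_+^n$. **Envelope classes.** Let $f:\mathbb N_+\to(0,1]$ satisfy $1<\sum_j f(j)<\infty$, and let $\Lambda=\Lambda(f)$ be the class of stationary memoryless sources with $\mathbb P_1\{j\}\le f(j)$ for all $j$. Its envelope distribution function is $F(k)=1-\sum_{j>k}f(j)$ if $\sum_{j>k}f(j)<1$ and $F(k)=0$ otherwise ($k\in\mathbb N$). A smoothed envelope distribution function is a distribution function on $\mathbb R_+$, also written $F$, that agrees with $F$ on $\mathbb N$, is continuously differentiable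 on $\mathbb R_+$ and has a positive derivative at each $x$ with $F(\lfloor x\rfloor)\in(0,1)$. With $U(t)=F^{-1}(1-1/t)$ its tail quantile function, $F\in\mathrm{MDA}(\gamma)$, for $\gamma>0$, means that there are $A_n>0$ such that $F(A_nx+U(n))^n\to\exp(-(1+\gamma x)^{-1/\gamma})$ for every $x$ with $1+\gamma x\ge0$ (the limit being $0$ when $1+\gamma x=0$). **The ETAC code.** For a message $x_{1:n}\in\mathbb N_+^n$ let $x_{1,i}\ge\dots\ge x_{i,i}$ be the non-increasing rearrangement of $x_1,\dots,x_i$, and let $$M_i=\min\bigl(\{i\}\cup\{k: 1\le k\le i,\ x_{k,i}\le k\}\bigr)\quad(i\ge1),\qquad M_0=0 .$$ The symbol $x_i$ is redacted when $x_i>M_{i-1}$ (in particular $x_1$ is redacted). Put $\tilde x_i=0$ if $x_i$ is redacted and $\tilde x_i=x_i$ otherwise, and $\tilde x_{n+1}=0$ as an end marker. Given $x_{1:i}$, the symbol $j\in\{0,\dots,M_i\}$ has predictive probability $$\tilde Q_{i+1}(j\mid x_{1:i})=\frac{n_i^j+\frac12}{i+\frac{M_i+1}2},$$ where $n_i^j$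 is the number of occurrences of $j$ in $x_{1:i}$ and $n_i^0=0$. The string $\tilde x_{1:n+1}$ is cut after each $0$; a piece whose product of predictive probabilities is $p$ is encoded by an arithmetic codeword of $\lceil\log(1/p)\rceil+1$ bits. Each redacted $x_i$ moreover contributes the penultimate Elias codeword of $x_i-M_{i-1}+1$, and the end marker that of $1$; the penultimate Elias codeword of $y$ has $2\ell(\ell(y))+\ell(y)$ bits, where $\ell(z)=\lfloor\log\max(z,1)\rfloor+1$. Let $\ell_n(x_{1:n})$ be the total number of bits. The coding probability of the ETAC code is $Q_n(x_{1:n})=2^{-\ell_n(x_{1:n})}\big/\sum_{y\in\mathbb N_+^n}2^{-\ell_n(y)}$. A measurable $L$, positive on $(0,\infty)$, is slowly varying if $L(tx)/L(t)\to1$ as $t\to\infty$ for every $x>0$. **Corollary.** Let $f$ be as above and ultimately non-increasing, and suppose that a smoothed envelope distribution function of $f$ belongs to $\mathrm{MDA}(\gamma)$ with $\gamma>0$. Then there are a slowly varying function $L_\Lambda$ and a constant $\kappa_\Lambda>0$ (both may depend on the envelope) such that, for all $n\ge1$, $$\kappa_\Lambda L_\Lambda(n)\,n^{\gamma/(\gamma+1)}\le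 R^+(\Lambda_n)\le R^+(Q_n,\Lambda_n),$$ and, as $n\to\infty$, $$R^+(Q_n,\Lambda_n)\le\bigl(\tfrac52+o_\Lambda(1)\bigr)\log n\; L_\Lambda(n)\,n^{\gamma/(\gamma+1)} .$$ Consequently both redundancies grow polynomially with exponent $\gamma/(\gamma+1)$: $$\lim_{n\to\infty}\frac{\log R^+(\Lambda_n)}{\log n}=\lim_{n\to\infty}\frac{\log R^+(Q_n,\Lambda_n)}{\log n}=\frac{\gamma}{\gamma+1}.$$ -/

import Mathlib

open MeasureTheory Filter Topology
open scoped ENNReal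

namespace EtacCode

noncomputable section

/-! ### Sources, redundancy -/

/-- The alphabet of positive integers carries the discrete σ-algebra. -/
instance instMeasurableSpacePNat : MeasurableSpace ℕ+ := ⊤

/-- The law `ℙ_n` of the first `n` symbols of the stationary memoryless source with marginal `P`. -/
def blockLaw (P : PMF ℕ+) (n : ℕ) : Measure (Fin n → ℕ+) :=
  Measure.pi fun _ : Fin n => P.toMeasure

/-- Kullback-Leibler divergence in bits (base-2 logarithm). -/
def klBits {α : Type*} [MeasurableSpace α] (μ ν : Measure α) : ℝ≥0∞ :=
  InformationTheory.klDiv μ ν / ENNReal.ofReal (Real.log 2)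

/-- The maximal redundancy `R⁺(Q_n, Λ_n)` of the coding distribution `Q` over the class of
memoryless sources whose marginals belong to `Λ`. -/
def maximalRedundancy {n : ℕ} (Q : PMF (Fin n → ℕ+)) (Λ : Set (PMF ℕ+)) : ℝ≥0∞ :=
  ⨆ P ∈ Λ, klBits (blockLaw P n) Q.toMeasure

/-- The minimax redundancy `R⁺(Λ_n)`. -/
def minimaxRedundancy (n : ℕ) (Λ : Set (PMF ℕ+)) : ℝ≥0∞ :=
  ⨅ Q : PMF (Fin n → ℕ+), maximalRedundancy Q Λ

/-! ### Envelope classes -/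

/-- Envelope functions: `f : ℕ₊ → (0,1]` with `1 < ∑ f < ∞`. -/
structure IsEnvelope (f : ℕ+ → ℝ) : Prop where
  pos : ∀ j, 0 < f j
  le_one : ∀ j, f j ≤ 1
  summable : Summable f
  one_lt_tsum : 1 < ∑' j, f j

/-- The envelope class `Λ(f)`; a stationary memoryless source is given by its marginal. -/
def envelopeClass (f : ℕ+ → ℝ) : Set (PMF ℕ+) :=
  {P | ∀ j, P j ≤ ENNReal.ofReal (f j)}

/-- `∑_{j > k} f j`. -/
def envelopeTail (f : ℕ+ → ℝ) (k : ℕ) : ℝ :=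
  ∑' j : ℕ+, if k < (j : ℕ) then f j else 0

/-- The envelope distribution function on `ℕ`. -/
def envelopeCDF (f : ℕ+ → ℝ) (k : ℕ) : ℝ :=
  if envelopeTail f k < 1 then 1 - envelopeTail f k else 0

/-- `F` is a smoothed envelope distribution function of `f`: a distribution function carried by
`[0, ∞)`, equal to the envelope distribution function on `ℕ`, continuously differentiable on
`[0, ∞)`, with positive derivative at each `x` for which the envelope distribution function at
`⌊x⌋` lies in `(0,1)`. -/
structure IsSmoothedEnvelopeCDF (f : ℕ+ → ℝ) (F : ℝ → ℝ) : Prop where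
  mono : Monotone F
  eq_zero_of_neg : ∀ x < 0, F x = 0
  tendsto_one : Tendsto F atTop (𝓝 1)
  eq_on_nat : ∀ k : ℕ, F k = envelopeCDF f k
  contDiffOn : ContDiffOn ℝ 1 F (Set.Ici 0)
  deriv_pos : ∀ x : ℝ, 0 ≤ x → envelopeCDF f ⌊x⌋₊ ∈ Set.Ioo (0 : ℝ) 1 →
    0 < derivWithin F (Set.Ici 0) x

/-- The generalized extreme value distribution function with index `γ`. -/
def gev (γ x : ℝ) : ℝ :=
  if γ = 0 then Real.exp (-Real.exp (-x))
  else if 0 < 1 + γ * x then Real.exp (-(1 + γ * x) ^ (-1 / γ))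
  else if 0 < γ then 0 else 1

/-- The tail quantile function `U(t) = F⁻¹(1 - 1/t)`. -/
def tailQuantile (F : ℝ → ℝ) (t : ℝ) : ℝ := sInf {x : ℝ | 1 - 1 / t ≤ F x}

/-- `F ∈ MDA(γ)`: for some positive `A_n`, `F(A_n x + U(n))^n → GEV_γ(x)` whenever
`1 + γ x ≥ 0`. -/
def InMDA (γ : ℝ) (F : ℝ → ℝ) : Prop :=
  ∃ A : ℕ → ℝ, (∀ n, 0 < A n) ∧ ∀ x : ℝ, 0 ≤ 1 + γ * x →
    Tendsto (fun n : ℕ => F (A n * x + tailQuantile F n) ^ n) atTop (𝓝 (gev γ x))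

/-- `f` is ultimately non-increasing. -/
def UltimatelyNonincreasing (f : ℕ+ → ℝ) : Prop :=
  ∃ N : ℕ+, AntitoneOn f (Set.Ici N)

/-- Slowly varying functions on `(0, ∞)`; the values at nonpositive reals play no role. -/
structure SlowlyVarying (L : ℝ → ℝ) : Prop where
  measurable : Measurable L
  pos : ∀ t, 0 < t → 0 < L t
  tendsto : ∀ x, 0 < x → Tendsto (fun t => L (t * x) / L t) atTop (𝓝 1)

/-! ### The ETAC code

A history `h` is the list `x_1, …, x_i` of the symbols read so far. -/

/-- The order statistic `x_{k,i}`: the `k`-th largest entry of `h`, for `1 ≤ k ≤ i`. -/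
def orderStat (h : List ℕ) (k : ℕ) : ℕ := (h.insertionSort (· ≥ ·)).getD (k - 1) 0

/-- The threshold `M_i = min (i, {k : x_{k,i} ≤ k})`; for the empty history `M_0 = 0`. -/
def threshold (h : List ℕ) : ℕ :=
  sInf (insert h.length {k : ℕ | 1 ≤ k ∧ k ≤ h.length ∧ orderStat h k ≤ k})

/-- The predictive probability of the symbol `j ∈ {0, …, M_i}` of the censored sequence given the
history: `(n_i^j + 1/2) / (i + (M_i + 1)/2)`, with `n_i^0 = 0`. -/
def predictive (h : List ℕ) (j : ℕ) : ℝ :=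
  ((if j = 0 then (0 : ℝ) else (h.count j : ℝ)) + 1 / 2) /
    ((h.length : ℝ) + ((threshold h : ℝ) + 1) / 2)

/-- The length in bits of the arithmetic codeword of a string of coding probability `p`. -/
def arithmeticLength (p : ℝ) : ℕ := ⌈Real.logb 2 (1 / p)⌉₊ + 1

/-- The length `⌊log₂ (max z 1)⌋ + 1` of the binary representation of `z`. -/
def binaryLength (z : ℕ) : ℕ := Nat.log 2 (max z 1) + 1

/-- The length in bits of the penultimate Elias codeword of `y ≥ 1`. -/
def eliasLength (y : ℕ) : ℕ := 2 * binaryLength (binaryLength y) + binaryLength y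

/-- The number of bits emitted by the ETAC encoder while it reads the remaining symbols (followed
by the end marker `0`), when `h` is the history and `p` is the coding probability of the
uncensored symbols read since the arithmetic encoder was last flushed. A symbol `a` at most
the threshold is fed to the arithmetic encoder. A symbol `a` beyond the threshold is replaced by
`0`, which flushes the arithmetic encoder, and `a - M_i + 1` is fed to the Elias encoder. The end
marker is coded as `0` followed by the Elias codeword of `1`. -/
def encoderBits : List ℕ → ℝ → List ℕ → ℕ
  | h, p, [] => arithmeticLength (p * predictive h 0) + eliasLength 1
  | h, p, a :: rest =>
    if a ≤ threshold h then encoderBits (h ++ [a]) (p * predictive h a) rest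
    else arithmeticLength (p * predictive h 0) + eliasLength (a - threshold h + 1)
      + encoderBits (h ++ [a]) 1 rest

/-- The length in bits of the ETAC encoding of the message `x_{1:n}`. -/
def etacLength {n : ℕ} (x : Fin n → ℕ+) : ℕ :=
  encoderBits [] 1 (List.ofFn fun i => (x i : ℕ))

/-! Kraft's inequality for the ETAC code, which makes its coding probability well defined. -/

theorem threshold_le_length (h : List ℕ) : threshold h ≤ h.length :=
  Nat.sInf_le (Set.mem_insert _ _)

theorem predictive_pos (h : List ℕ) (j : ℕ) : 0 < predictive h j := by
  unfold predictive
  split_ifs <;> positivity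

theorem pow_arithmeticLength_le {p : ℝ} (hp : 0 < p) :
    (2⁻¹ : ℝ≥0∞) ^ arithmeticLength p ≤ ENNReal.ofReal p := by
  have h2 : (2⁻¹ : ℝ≥0∞) = ENNReal.ofReal (2⁻¹ : ℝ) := by
    rw [ENNReal.ofReal_inv_of_pos (by norm_num)]; simp
  rw [h2, ← ENNReal.ofReal_pow (by norm_num)]
  apply ENNReal.ofReal_le_ofReal
  have h1 : Real.logb 2 (1 / p) ≤ (arithmeticLength p : ℕ) := by
    unfold arithmeticLength
    push_cast
    linarith [Nat.le_ceil (Real.logb 2 (1 / p))]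
  rw [Real.logb_le_iff_le_rpow (by norm_num) (by positivity), Real.rpow_natCast] at h1
  rw [inv_pow]
  rw [div_le_iff₀ hp] at h1
  rw [inv_le_iff_one_le_mul₀ (by positivity)]
  linarith

theorem tsum_binaryLength (g : ℕ → ℝ≥0∞) :
    ∑' y : ℕ, g (binaryLength (y + 1)) = ∑' s : ℕ, 2 ^ s * g (s + 1) := by
  rw [← ENNReal.tsum_fiberwise _ (fun y : ℕ => Nat.log 2 (y + 1))]
  refine tsum_congr fun s => ?_
  have hset : (fun y : ℕ => Nat.log 2 (y + 1)) ⁻¹' {s}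
      = ((Finset.Ico (2 ^ s - 1) (2 ^ (s + 1) - 1) : Finset ℕ) : Set ℕ) := by
    ext y
    have h1 : 1 ≤ 2 ^ s := Nat.one_le_two_pow
    have h2 : 1 ≤ 2 ^ (s + 1) := Nat.one_le_two_pow
    simp only [Set.mem_preimage, Set.mem_singleton_iff, Finset.coe_Ico, Set.mem_Ico]
    rw [Nat.log_eq_iff (Or.inr ⟨by norm_num, by omega⟩)]
    omega
  rw [hset, Finset.tsum_subtype' (Finset.Ico (2 ^ s - 1) (2 ^ (s + 1) - 1))
    (fun y => g (binaryLength (y + 1)))]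
  have hconst : ∀ y ∈ Finset.Ico (2 ^ s - 1) (2 ^ (s + 1) - 1),
      g (binaryLength (y + 1)) = g (s + 1) := by
    intro y hy
    have hy' : y ∈ (fun y : ℕ => Nat.log 2 (y + 1)) ⁻¹' {s} := by
      rw [hset]; exact_mod_cast hy
    have : Nat.log 2 (y + 1) = s := hy'
    simp [binaryLength, this]
  rw [Finset.sum_congr rfl hconst, Finset.sum_const, Nat.card_Ico, nsmul_eq_mul]
  congr 1
  have h1 : 1 ≤ 2 ^ s := Nat.one_le_two_pow
  have : 2 ^ (s + 1) - 1 - (2 ^ s - 1) = 2 ^ s := by rw [pow_succ]; omega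
  rw [this]; push_cast; rfl

/-- Kraft's inequality for the penultimate Elias code. -/
theorem tsum_eliasLength_le :
    ∑' y : ℕ, (2⁻¹ : ℝ≥0∞) ^ eliasLength (y + 1) ≤ 1 := by
  have hcancel : ∀ s : ℕ, (2 : ℝ≥0∞) ^ s * 2⁻¹ ^ s = 1 := fun s => by
    rw [← mul_pow, ENNReal.mul_inv_cancel (by norm_num) (by norm_num), one_pow]
  have e1 : ∑' y : ℕ, (2⁻¹ : ℝ≥0∞) ^ eliasLength (y + 1)
      = ∑' s : ℕ, (2⁻¹ : ℝ≥0∞) * 2⁻¹ ^ (2 * binaryLength (s + 1)) := by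
    have := tsum_binaryLength (fun k => (2⁻¹ : ℝ≥0∞) ^ (2 * binaryLength k + k))
    unfold eliasLength
    rw [this]
    refine tsum_congr fun s => ?_
    rw [pow_add, pow_succ (2⁻¹ : ℝ≥0∞) s]
    calc _ = (2 ^ s * 2⁻¹ ^ s) * ((2⁻¹ : ℝ≥0∞) * 2⁻¹ ^ (2 * binaryLength (s + 1))) := by ring
      _ = _ := by rw [hcancel, one_mul]
  rw [e1, ENNReal.tsum_mul_left,
    tsum_binaryLength (fun k => (2⁻¹ : ℝ≥0∞) ^ (2 * k))]
  have e2 : ∀ s : ℕ, (2 : ℝ≥0∞) ^ s * 2⁻¹ ^ (2 * (s + 1)) = (2⁻¹ * 2⁻¹) * 2⁻¹ ^ s := by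
    intro s
    calc (2 : ℝ≥0∞) ^ s * 2⁻¹ ^ (2 * (s + 1))
        = (2 ^ s * 2⁻¹ ^ s) * ((2⁻¹ * 2⁻¹) * 2⁻¹ ^ s) := by ring
      _ = _ := by rw [hcancel, one_mul]
  simp_rw [e2]
  rw [ENNReal.tsum_mul_left, ENNReal.tsum_geometric, ENNReal.one_sub_inv_two, inv_inv]
  have h2 : (2⁻¹ : ℝ≥0∞) ≤ 1 := by simp
  calc (2⁻¹ : ℝ≥0∞) * (2⁻¹ * 2⁻¹ * 2) = 2⁻¹ * 2⁻¹ * (2⁻¹ * 2) := by ring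
    _ = 2⁻¹ * 2⁻¹ := by rw [ENNReal.inv_mul_cancel (by norm_num) (by norm_num), mul_one]
    _ ≤ 1 * 1 := mul_le_mul' h2 h2
    _ = 1 := one_mul 1

theorem sum_count_le (h : List ℕ) (s : Finset ℕ) : ∑ j ∈ s, h.count j ≤ h.length := by
  induction h with
  | nil => simp
  | cons a t ih =>
    simp only [List.count_cons, Finset.sum_add_distrib, List.length_cons]
    have : ∑ j ∈ s, (if (a == j) = true then 1 else 0) ≤ 1 := by
      simp only [beq_iff_eq, Finset.sum_ite_eq]
      split_ifs <;> simp
    omega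

theorem sum_predictive_le (h : List ℕ) :
    predictive h 0 + ∑ j ∈ Finset.Icc 1 (threshold h), predictive h j ≤ 1 := by
  have hD : (0 : ℝ) < (h.length : ℝ) + ((threshold h : ℝ) + 1) / 2 := by positivity
  have h1 : ∑ j ∈ Finset.Icc 1 (threshold h), predictive h j
      = (∑ j ∈ Finset.Icc 1 (threshold h), ((h.count j : ℝ) + 1 / 2)) /
        ((h.length : ℝ) + ((threshold h : ℝ) + 1) / 2) := by
    rw [Finset.sum_div]
    refine Finset.sum_congr rfl fun j hj => ?_
    have : j ≠ 0 := by have := (Finset.mem_Icc.1 hj).1; omega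
    simp [predictive, this]
  have h2 : ((∑ j ∈ Finset.Icc 1 (threshold h), h.count j : ℕ) : ℝ) ≤ h.length := by
    exact_mod_cast sum_count_le h _
  rw [h1]
  simp only [predictive, if_true]
  rw [← add_div, div_le_one hD, Finset.sum_add_distrib, Finset.sum_const, Nat.card_Icc,
    nsmul_eq_mul]
  push_cast at h2 ⊢
  linarith

theorem encoderBits_kraft (n : ℕ) : ∀ (h : List ℕ) (p : ℝ), 0 < p →
    ∑' x : Fin n → ℕ+, (2⁻¹ : ℝ≥0∞) ^ encoderBits h p (List.ofFn fun i => (x i : ℕ))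
      ≤ ENNReal.ofReal p := by
  have hhalf : ∀ k : ℕ, (2⁻¹ : ℝ≥0∞) ^ k ≤ 1 := fun k => pow_le_one' (by simp) k
  induction n with
  | zero =>
    intro h p hp
    have hq1 : predictive h 0 ≤ 1 := by
      have := sum_predictive_le h
      have h0 : 0 ≤ ∑ j ∈ Finset.Icc 1 (threshold h), predictive h j :=
        Finset.sum_nonneg fun j _ => (predictive_pos h j).le
      linarith
    rw [tsum_fintype]
    simp only [List.ofFn_zero, encoderBits, Finset.univ_unique, Finset.sum_singleton, pow_add]
    calc (2⁻¹ : ℝ≥0∞) ^ arithmeticLength (p * predictive h 0) * 2⁻¹ ^ eliasLength 1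
        ≤ ENNReal.ofReal (p * predictive h 0) * 1 :=
          mul_le_mul' (pow_arithmeticLength_le (mul_pos hp (predictive_pos h 0))) (hhalf _)
      _ ≤ ENNReal.ofReal p := by
          rw [mul_one]
          exact ENNReal.ofReal_le_ofReal (mul_le_of_le_one_right hp.le hq1)
  | succ n ih =>
    intro h p hp
    set T := threshold h with hT
    rw [← (Fin.consEquiv fun _ : Fin (n + 1) => ℕ+).tsum_eq, ENNReal.tsum_prod']
    have hstep : ∀ a : ℕ+,
        ∑' y : Fin n → ℕ+, (2⁻¹ : ℝ≥0∞) ^ encoderBits h p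
          (List.ofFn fun i => (((Fin.consEquiv fun _ : Fin (n + 1) => ℕ+) (a, y)) i : ℕ))
        ≤ (if (a : ℕ) ≤ T then ENNReal.ofReal (p * predictive h a) else 0)
          + (if (a : ℕ) ≤ T then 0 else
              ENNReal.ofReal (p * predictive h 0) * 2⁻¹ ^ eliasLength ((a : ℕ) - T + 1)) := by
      intro a
      simp only [Fin.consEquiv, Equiv.coe_fn_mk, List.ofFn_succ, Fin.cons_zero, Fin.cons_succ,
        encoderBits]
      by_cases haT : (a : ℕ) ≤ T
      · simp only [haT, ← hT, if_true, add_zero]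
        exact ih _ _ (mul_pos hp (predictive_pos h a))
      · simp only [haT, ← hT, if_false, zero_add, pow_add]
        rw [ENNReal.tsum_mul_left]
        have := ih (h ++ [(a : ℕ)]) 1 one_pos
        rw [ENNReal.ofReal_one] at this
        calc _ ≤ ENNReal.ofReal (p * predictive h 0) * 2⁻¹ ^ eliasLength ((a : ℕ) - T + 1) * 1 :=
              mul_le_mul' (mul_le_mul'
                (pow_arithmeticLength_le (mul_pos hp (predictive_pos h 0))) le_rfl) this
          _ = _ := mul_one _
    refine (ENNReal.tsum_le_tsum hstep).trans ?_
    rw [ENNReal.tsum_add]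
    have hA : ∑' a : ℕ+, (if (a : ℕ) ≤ T then ENNReal.ofReal (p * predictive h a) else 0)
        ≤ ENNReal.ofReal (p * ∑ j ∈ Finset.Icc 1 T, predictive h j) := by
      rw [Finset.mul_sum, ENNReal.ofReal_sum_of_nonneg
        (fun j _ => (mul_pos hp (predictive_pos h j)).le)]
      rw [← Finset.tsum_subtype (Finset.Icc 1 T) (fun j => ENNReal.ofReal (p * predictive h j))]
      rw [← Function.Injective.tsum_eq (g := fun y : {a : ℕ+ // (a : ℕ) ≤ T} => y.1)
        Subtype.val_injective]
      · have hinj : Function.Injective (fun y : {a : ℕ+ // (a : ℕ) ≤ T} =>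
            (⟨(y.1 : ℕ), Finset.mem_Icc.2 ⟨y.1.2, y.2⟩⟩ : {j // j ∈ Finset.Icc 1 T})) := by
          intro x y hxy
          apply Subtype.ext
          apply PNat.eq
          simpa using hxy
        refine le_trans (le_of_eq (tsum_congr fun y => ?_))
          (ENNReal.tsum_comp_le_tsum_of_injective hinj
            (fun j => ENNReal.ofReal (p * predictive h j.1)))
        have hy := y.2
        simp [hy]
      · intro a ha
        have haT : (a : ℕ) ≤ T := by
          by_contra hcon
          simp [hcon] at ha
        exact ⟨⟨a, haT⟩, rfl⟩
    have hB : ∑' a : ℕ+, (if (a : ℕ) ≤ T then (0 : ℝ≥0∞) else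
        ENNReal.ofReal (p * predictive h 0) * 2⁻¹ ^ eliasLength ((a : ℕ) - T + 1))
        ≤ ENNReal.ofReal (p * predictive h 0) := by
      have hle : ∑' a : ℕ+, (if (a : ℕ) ≤ T then (0 : ℝ≥0∞) else
          ENNReal.ofReal (p * predictive h 0) * 2⁻¹ ^ eliasLength ((a : ℕ) - T + 1))
          ≤ ∑' y : ℕ, ENNReal.ofReal (p * predictive h 0) * 2⁻¹ ^ eliasLength (y + 1) := by
        rw [← Function.Injective.tsum_eq (g := fun y : {a : ℕ+ // T < (a : ℕ)} => y.1)
          Subtype.val_injective]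
        · have hinj : Function.Injective (fun y : {a : ℕ+ // T < (a : ℕ)} => (y.1 : ℕ) - T) := by
            intro x y hxy
            have hx := x.2
            have hy := y.2
            have : (x.1 : ℕ) - T = (y.1 : ℕ) - T := hxy
            apply Subtype.ext
            apply PNat.eq
            omega
          refine le_trans (le_of_eq (tsum_congr fun y => ?_)) (ENNReal.tsum_comp_le_tsum_of_injective hinj
            (fun y : ℕ => ENNReal.ofReal (p * predictive h 0) * 2⁻¹ ^ eliasLength (y + 1)))
          have hy := y.2
          simp [not_le.2 hy]
        · intro a ha
          have haT : ¬ (a : ℕ) ≤ T := by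
            intro hcon
            simp [hcon] at ha
          exact ⟨⟨a, not_le.1 haT⟩, rfl⟩
      refine hle.trans ?_
      rw [ENNReal.tsum_mul_left]
      calc _ ≤ ENNReal.ofReal (p * predictive h 0) * 1 := mul_le_mul' le_rfl tsum_eliasLength_le
        _ = _ := mul_one _
    refine (add_le_add hA hB).trans ?_
    rw [← ENNReal.ofReal_add
      (mul_nonneg hp.le (Finset.sum_nonneg fun j _ => (predictive_pos h j).le))
      (mul_pos hp (predictive_pos h 0)).le]
    apply ENNReal.ofReal_le_ofReal
    have := sum_predictive_le h
    rw [← hT] at this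
    nlinarith

theorem etacLength_kraft (n : ℕ) :
    ∑' x : Fin n → ℕ+, (2⁻¹ : ℝ≥0∞) ^ etacLength x ≤ 1 := by
  simpa [etacLength] using encoderBits_kraft n [] 1 one_pos

theorem tsum_etacLength_ne_zero (n : ℕ) :
    ∑' x : Fin n → ℕ+, (2⁻¹ : ℝ≥0∞) ^ etacLength x ≠ 0 := by
  intro h0
  have := ENNReal.tsum_eq_zero.1 h0 (fun _ => 1)
  simp at this

/-- The coding probability `Q_n` of the ETAC code: `Q_n(x) ∝ 2^{-ℓ(x)}`, with `ℓ` the codelength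
in bits. -/
def etac (n : ℕ) : PMF (Fin n → ℕ+) :=
  PMF.normalize (fun x : Fin n → ℕ+ => (2⁻¹ : ℝ≥0∞) ^ etacLength x)
    (tsum_etacLength_ne_zero n)
    (ne_top_of_le_ne_top ENNReal.one_ne_top (etacLength_kraft n))

end

end EtacCode

/-!
# Redundancy of the ETAC code over heavy-tailed envelope classes

Let `G` be the envelope tail and let the effective alphabet size `T n` be the largest `t` with
`t ≤ n * G t`: beyond it, about as many symbols are expected in a message of length `n` as there are
symbols below it. Both redundancies are compared with `T n`:
`κ * T n ≤ R⁺(Λ_n)` and `R⁺(Q_n, Λ_n) ≤ K * log n * T n`. Since the slowly varying function is only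
determined up to a constant factor, `L t = (2 / 5) * K * T t / t ^ (γ / (γ + 1))` gives the claim.

*Regular variation.* If `F ∈ MDA(γ)`, then `n * (1 - F (W n + a n * y)) → y ^ (-1/γ)` for `y > 0`,
where `a n = A n / γ` and `W n = U n - a n`. Comparing this limit at `n` and at `n / 2` shows that
`a (n / 2) / a n → 2 ^ (-γ)` and `W (n / 2) - W n = o(a n)`, so that `W n = o(a n)` by dyadic summation
and the centering can be dropped (`tendsto_scale_atTop`). Hence `G` is regularly varying of index
`-1/γ` (`realTail_regularlyVarying`) and `T` of index `γ / (γ + 1)`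
(`effectiveSize_regularlyVarying`).

*Lower bound.* About `T n` symbols have envelope at least of the order of `1 / n`, since the envelope
is eventually monotone and has mass of the order of `T n / n` just beyond `T n / 2`. Group them in
pairs and consider the sources that use, with probability `c / n`, exactly one symbol of each pair.
Whenever a symbol of a pair is seen, one bit is learned, and each pair is seen with probability
bounded away from zero (`le_maximalRedundancy_of_pairs`).

*Upper bound.* The pointwise redundancy of the code is controlled by the numbers of redacted and of
distinct symbols, each multiplied by a factor of order `log n`, and by `∑ M_{i-1} / i`
(`encoderBits_add_log_le`). The mixture part is compared with the multinomial bound for the word of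
non-redacted symbols, and the Elias codeword of a redacted symbol `a` is paid for by its probability,
which is at most `f a` and decays faster than `1 / a` by a power. For `k` just above `T i`, the
threshold `M_i` exceeds `k` by at most the number of symbols beyond `k`, so its mean is `O(T i)`. By
exchangeability and a leave-one-out argument, the symbol at time `i` is redacted with probability at
most `E M_i / i` (`mul_blockLaw_redacted_le`), and `∑ i ≤ n, T i / i = O(T n)` because `T` has a
positive index (`sum_div_le`).
-/

namespace EtacCode

/-! ### From the extremal limit to regular variation of the envelope tail -/

/-- Both sides of `u * -log u ≤ 1 - u ≤ -log u`, multiplied by `n`, have the same limit. -/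
theorem tendsto_mul_one_sub_of_pow {u : ℕ → ℝ} {l : ℝ} (h0 : ∀ n, 0 ≤ u n)
    (h : Tendsto (fun n => u n ^ n) atTop (𝓝 (Real.exp (-l)))) :
    Tendsto (fun n : ℕ => (n : ℝ) * (1 - u n)) atTop (𝓝 l) := by
  have hpos : ∀ᶠ n in atTop, 0 < u n := by
    filter_upwards [h.eventually (lt_mem_nhds (Real.exp_pos (-l))), eventually_ge_atTop 1]
      with n hn hn1
    rcases (h0 n).eq_or_lt with h | h
    · rw [← h, zero_pow (by omega)] at hn
      exact absurd hn (lt_irrefl _)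
    · exact h
  have hv : Tendsto (fun n : ℕ => (n : ℝ) * -Real.log (u n)) atTop (𝓝 l) := by
    have := (h.log (Real.exp_ne_zero _)).neg
    rw [Real.log_exp, neg_neg] at this
    refine this.congr fun n => ?_
    rw [Real.log_pow]; ring
  have hlog : Tendsto (fun n : ℕ => -Real.log (u n)) atTop (𝓝 0) := by
    have := hv.mul tendsto_inv_atTop_nhds_zero_nat
    rw [mul_zero] at this
    refine this.congr' ?_
    filter_upwards [eventually_ge_atTop 1] with n hn
    have : (n : ℝ) ≠ 0 := by positivity
    field_simp
  have hu : Tendsto u atTop (𝓝 1) := by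
    have := (Real.continuous_exp.tendsto _).comp hlog.neg
    rw [neg_zero, Real.exp_zero] at this
    refine this.congr' ?_
    filter_upwards [hpos] with n hn
    simp [Real.exp_log hn]
  have hlow : Tendsto (fun n : ℕ => u n * ((n : ℝ) * -Real.log (u n))) atTop (𝓝 l) := by
    simpa using hu.mul hv
  refine tendsto_of_tendsto_of_tendsto_of_le_of_le' hlow hv ?_ ?_
  · filter_upwards [hpos] with n hn
    have h2 := Real.one_sub_inv_le_log_of_pos hn
    have h3 : u n * -Real.log (u n) ≤ 1 - u n := by
      have := mul_le_mul_of_nonneg_left h2 hn.le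
      rw [mul_sub, mul_inv_cancel₀ hn.ne'] at this
      linarith
    nlinarith [mul_le_mul_of_nonneg_left h3 (Nat.cast_nonneg (α := ℝ) n)]
  · filter_upwards [hpos] with n hn
    have := Real.log_le_sub_one_of_pos hn
    exact mul_le_mul_of_nonneg_left (by linarith) (Nat.cast_nonneg n)

/-- A normalization `z ↦ W n + a n * z` under which the monotone function `H` has the tail limit
`z ^ (-α)` is determined up to `o(a n)`: any sequence at which `n * H` has the limit `w ^ (-α)` is
`W n + a n * (w + o(1))`. -/
theorem tendsto_normalized {H : ℝ → ℝ} (hH : Antitone H) {α : ℝ} (hα : 0 < α) {a W : ℕ → ℝ}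
    (ha : ∀ n, 0 < a n)
    (hlim : ∀ z, 0 < z → Tendsto (fun n : ℕ => (n : ℝ) * H (W n + a n * z)) atTop (𝓝 (z ^ (-α))))
    {b : ℕ → ℝ} {w : ℝ} (hw : 0 < w)
    (hb : Tendsto (fun n : ℕ => (n : ℝ) * H (b n)) atTop (𝓝 (w ^ (-α)))) :
    Tendsto (fun n => (b n - W n) / a n) atTop (𝓝 w) := by
  have key : ∀ (n : ℕ) (s t : ℝ), (n : ℝ) * H s < n * H t → t < s := by
    intro n s t h
    by_contra hc
    exact absurd (mul_le_mul_of_nonneg_left (hH (not_lt.1 hc)) (Nat.cast_nonneg n)) (not_le.2 h)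
  refine tendsto_order.2 ⟨fun c hc => ?_, fun c hc => ?_⟩
  · have hz : 0 < max c (w / 2) := lt_max_of_lt_right (by linarith)
    have hzw : max c (w / 2) < w := max_lt hc (by linarith)
    have := hb.eventually_lt (hlim _ hz) (Real.rpow_lt_rpow_of_neg hz hzw (by linarith))
    filter_upwards [this] with n hn
    have := key n _ _ hn
    rw [lt_div_iff₀ (ha n)]
    nlinarith [mul_le_mul_of_nonneg_right (le_max_left c (w / 2)) (ha n).le]
  · have hz : 0 < c := hw.trans hc
    have := (hlim _ hz).eventually_lt hb (Real.rpow_lt_rpow_of_neg hw hc (by linarith))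
    filter_upwards [this] with n hn
    have := key n _ _ hn
    rw [div_lt_iff₀ (ha n)]
    linarith

theorem tendsto_nat_div_two : Tendsto (fun n : ℕ => n / 2) atTop atTop :=
  Nat.tendsto_div_const_atTop (by norm_num)

/-- Halving `n` multiplies the scale by a factor tending to `s < 1`, and moves the centering by
`o(a n)`. -/
theorem tendsto_scale_half {H : ℝ → ℝ} (hH : Antitone H) {α s : ℝ} (hα : 0 < α)
    (hs : 0 < s) (hs2 : s ^ (-α) = 2) {a W : ℕ → ℝ} (ha : ∀ n, 0 < a n)
    (hlim : ∀ z, 0 < z → Tendsto (fun n : ℕ => (n : ℝ) * H (W n + a n * z)) atTop (𝓝 (z ^ (-α)))) :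
    Tendsto (fun n => a (n / 2) / a n) atTop (𝓝 s) ∧
      Tendsto (fun n => (W (n / 2) - W n) / a n) atTop (𝓝 0) := by
  have key : ∀ y, 0 < y →
      Tendsto (fun n => (W (n / 2) + a (n / 2) * y - W n) / a n) atTop (𝓝 (s * y)) := by
    intro y hy
    refine tendsto_normalized hH hα ha hlim (by positivity) ?_
    have h1 := hlim y hy
    have h0 : Tendsto (fun n : ℕ => H (W n + a n * y)) atTop (𝓝 0) := by
      have := h1.mul tendsto_inv_atTop_nhds_zero_nat
      rw [mul_zero] at this
      refine this.congr' ?_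
      filter_upwards [eventually_ge_atTop 1] with n hn
      have : (n : ℝ) ≠ 0 := by positivity
      field_simp
    have h2 := h1.comp tendsto_nat_div_two
    have h3 := h0.comp tendsto_nat_div_two
    have h4 : Tendsto (fun n : ℕ => ((n % 2 : ℕ) : ℝ) * H (W (n / 2) + a (n / 2) * y))
        atTop (𝓝 0) := by
      refine squeeze_zero_norm (fun n => ?_) (tendsto_norm_zero.comp h3)
      rw [norm_mul]
      have : ‖((n % 2 : ℕ) : ℝ)‖ ≤ 1 := by
        rw [Real.norm_natCast]; exact_mod_cast (by omega : n % 2 ≤ 1)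
      exact mul_le_of_le_one_left (norm_nonneg _) this
    -- `n = 2 * (n / 2) + n % 2`, and the remainder contributes a vanishing term
    have h5 := (h2.const_mul 2).add h4
    rw [add_zero] at h5
    rw [Real.mul_rpow hs.le hy.le, hs2]
    refine h5.congr fun n => ?_
    have : (n : ℝ) = 2 * ((n / 2 : ℕ) : ℝ) + ((n % 2 : ℕ) : ℝ) := by
      exact_mod_cast (by omega : n = 2 * (n / 2) + n % 2)
    simp only [Function.comp]
    conv_rhs => rw [this]
    ring
  have k1 := key 1 one_pos
  have k2 := key 2 two_pos
  constructor
  · have := k2.sub k1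
    rw [show s * 2 - s * 1 = s by ring] at this
    refine this.congr fun n => ?_
    rw [← sub_div]; congr 1; ring
  · have := (k1.const_mul 2).sub k2
    rw [show 2 * (s * 1) - s * 2 = 0 by ring] at this
    refine this.congr fun n => ?_
    rw [← mul_div_assoc, ← sub_div]; congr 1; ring

/-- Dyadic summation: increments of order `a n` between `n / 2` and `n` add up to order `a n`, when `a`
grows geometrically along doublings. -/
theorem abs_le_const_add_mul_of_halving {a W : ℕ → ℝ} (ha : ∀ n, 0 ≤ a n) {c δ : ℝ}
    (hc : c < 1) (hδ : 0 ≤ δ)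
    (h : ∀ᶠ n in atTop, a (n / 2) ≤ c * a n ∧ |W (n / 2) - W n| ≤ δ * a n) :
    ∃ C, ∀ n, |W n| ≤ C + δ / (1 - c) * a n := by
  obtain ⟨N, hN⟩ := eventually_atTop.1 h
  have hd : 0 ≤ δ / (1 - c) := div_nonneg hδ (by linarith)
  refine ⟨∑ i ∈ Finset.range (N + 1), |W i|, fun n => ?_⟩
  induction n using Nat.strong_induction_on with
  | _ n ih =>
    by_cases hn : n ≤ N
    · have := Finset.single_le_sum (f := fun i => |W i|) (fun i _ => abs_nonneg (W i))
        (Finset.mem_range.2 (Nat.lt_succ_of_le hn))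
      have := mul_nonneg hd (ha n)
      linarith
    · obtain ⟨h1, h2⟩ := hN n (by omega)
      have h3 := ih (n / 2) (by omega)
      have h4 : |W n| ≤ |W (n / 2)| + |W (n / 2) - W n| := by
        have := abs_sub_abs_le_abs_sub (W n) (W (n / 2))
        rw [abs_sub_comm] at this
        linarith
      have h5 := mul_le_mul_of_nonneg_left h1 hd
      have h6 : δ / (1 - c) * (c * a n) + δ * a n = δ / (1 - c) * a n := by
        have : 1 - c ≠ 0 := by linarith
        field_simp
        ring
      linarith

/-- In the Fréchet domain the centering can be dropped: `W n = o(a n)`, and `a n → ∞`. -/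
theorem tendsto_scale_atTop {H : ℝ → ℝ} (hH : Antitone H) (hpos : ∀ x, 0 < H x) {α : ℝ}
    (hα : 0 < α) {a W : ℕ → ℝ} (ha : ∀ n, 0 < a n)
    (hlim : ∀ z, 0 < z → Tendsto (fun n : ℕ => (n : ℝ) * H (W n + a n * z)) atTop (𝓝 (z ^ (-α)))) :
    Tendsto a atTop atTop ∧ Tendsto (fun n => W n / a n) atTop (𝓝 0) := by
  -- the scale ratio of a halving of `n`
  set s : ℝ := 2 ^ (-(1 / α)) with hsdef
  have hs : 0 < s := by positivity
  have hs1 : s < 1 := Real.rpow_lt_one_of_one_lt_of_neg (by norm_num) (by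
    have : 0 < 1 / α := by positivity
    linarith)
  have hs2 : s ^ (-α) = 2 := by
    rw [hsdef, ← Real.rpow_mul (by norm_num)]
    have : -(1 / α) * -α = 1 := by field_simp
    rw [this, Real.rpow_one]
  obtain ⟨k1, k2⟩ := tendsto_scale_half hH hα hs hs2 ha hlim
  set c := (1 + s) / 2 with hc
  have hc1 : c < 1 := by rw [hc]; linarith
  have bound : ∀ η, 0 < η → ∃ C, ∀ n, |W n| ≤ C + η * a n := by
    intro η hη
    have hδ : 0 < η * (1 - c) := mul_pos hη (by linarith)
    obtain ⟨C, hC⟩ := abs_le_const_add_mul_of_halving (W := W) (fun n => (ha n).le) hc1 hδ.le (by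
      have h2 := k2.abs.eventually (gt_mem_nhds (show |(0 : ℝ)| < η * (1 - c) by simpa using hδ))
      filter_upwards [k1.eventually (gt_mem_nhds (show s < c by rw [hc]; linarith)), h2]
        with n h1 h2
      refine ⟨((div_lt_iff₀ (ha n)).1 h1).le, ?_⟩
      rw [abs_div, abs_of_pos (ha n), div_lt_iff₀ (ha n)] at h2
      exact h2.le)
    refine ⟨C, fun n => ?_⟩
    have := hC n
    rwa [mul_div_assoc, div_self (by linarith), mul_one] at this
  -- `H (W n + a n) → 0` forces `W n + a n → ∞`, as `H` is positive and monotone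
  have htop : Tendsto (fun n => W n + a n) atTop atTop := by
    have h0 : Tendsto (fun n : ℕ => H (W n + a n * 1)) atTop (𝓝 0) := by
      have := (hlim 1 one_pos).mul tendsto_inv_atTop_nhds_zero_nat
      rw [mul_zero] at this
      refine this.congr' ?_
      filter_upwards [eventually_ge_atTop 1] with n hn
      have : (n : ℝ) ≠ 0 := by positivity
      field_simp
    refine tendsto_atTop.2 fun b => ?_
    filter_upwards [h0.eventually (gt_mem_nhds (hpos b))] with n hn
    rw [mul_one] at hn
    by_contra hcon
    exact absurd (hH (not_le.1 hcon).le) (not_le.2 hn)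
  have hatop : Tendsto a atTop atTop := by
    obtain ⟨C, hC⟩ := bound 1 one_pos
    refine tendsto_atTop.2 fun b => ?_
    filter_upwards [tendsto_atTop.1 htop (C + 2 * b)] with n hn
    have := hC n
    have := le_abs_self (W n)
    linarith
  refine ⟨hatop, ?_⟩
  rw [Metric.tendsto_atTop']
  intro η hη
  obtain ⟨C, hC⟩ := bound (η / 2) (by linarith)
  obtain ⟨N, hN⟩ := eventually_atTop.1 (tendsto_atTop.1 hatop (2 * C / η + 1))
  refine ⟨N, fun n hn => ?_⟩
  have h1 := hN n hn.le
  have h2 := hC n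
  rw [Real.dist_eq, sub_zero, abs_div, abs_of_pos (ha n), div_lt_iff₀ (ha n)]
  have : C < η / 2 * a n := by
    have := mul_lt_mul_of_pos_left (show 2 * C / η < a n by linarith) (half_pos hη)
    calc C = η / 2 * (2 * C / η) := by field_simp
      _ < _ := this
  linarith

/-- Strict bounds on `y ^ (-α)` persist at some larger, resp. smaller, argument. -/
theorem exists_between_rpow {α y : ℝ} (hy : 0 < y) {b : ℝ} :
    (b < y ^ (-α) → ∃ z, y < z ∧ b < z ^ (-α)) ∧
      (y ^ (-α) < b → ∃ z, 0 < z ∧ z < y ∧ z ^ (-α) < b) := by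
  have hcont : ContinuousAt (fun z : ℝ => z ^ (-α)) y :=
    Real.continuousAt_rpow_const _ _ (Or.inl hy.ne')
  constructor
  · intro hb
    have h1 := (hcont.eventually (lt_mem_nhds hb)).filter_mono (nhdsWithin_le_nhds (s := Set.Ioi y))
    obtain ⟨z, hz, hz2⟩ := (h1.and self_mem_nhdsWithin).exists
    exact ⟨z, hz2, hz⟩
  · intro hb
    have h1 := ((hcont.eventually (gt_mem_nhds hb)).and (lt_mem_nhds hy)).filter_mono
      (nhdsWithin_le_nhds (s := Set.Iio y))
    obtain ⟨z, hz, hz2⟩ := (h1.and self_mem_nhdsWithin).exists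
    exact ⟨z, hz.2, hz2, hz.1⟩

/-- The tail limit along the sequence `a n` without centering, at integer points. -/
theorem tendsto_mul_floor {H : ℝ → ℝ} (hH : Antitone H) (hpos : ∀ x, 0 < H x) {α : ℝ}
    (hα : 0 < α) {a W : ℕ → ℝ} (ha : ∀ n, 0 < a n)
    (hlim : ∀ z, 0 < z → Tendsto (fun n : ℕ => (n : ℝ) * H (W n + a n * z)) atTop (𝓝 (z ^ (-α))))
    {y : ℝ} (hy : 0 < y) :
    Tendsto (fun n : ℕ => (n : ℝ) * H (⌊a n * y⌋₊)) atTop (𝓝 (y ^ (-α))) := by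
  obtain ⟨hatop, hW⟩ := tendsto_scale_atTop hH hpos hα ha hlim
  refine tendsto_order.2 ⟨fun b hb => ?_, fun b hb => ?_⟩
  · obtain ⟨z, hyz, hbz⟩ := (exists_between_rpow hy).1 hb
    filter_upwards [(hlim z (hy.trans hyz)).eventually (lt_mem_nhds hbz),
      hW.eventually (lt_mem_nhds (show y - z < 0 by linarith))] with n h1 h2
    refine h1.trans_le (mul_le_mul_of_nonneg_left (hH ?_) (Nat.cast_nonneg n))
    refine (Nat.floor_le (mul_nonneg (ha n).le hy.le)).trans ?_
    rw [lt_div_iff₀ (ha n)] at h2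
    linarith
  · obtain ⟨z, hz, hzy, hbz⟩ := (exists_between_rpow hy).2 hb
    have hW1 : Tendsto (fun n => (W n + 1) / a n) atTop (𝓝 0) := by
      have := hW.add (tendsto_inv_atTop_zero.comp hatop)
      rw [add_zero] at this
      refine this.congr fun n => ?_
      simp only [Function.comp]
      rw [add_div, one_div]
    filter_upwards [(hlim z hz).eventually (gt_mem_nhds hbz),
      hW1.eventually (gt_mem_nhds (show 0 < y - z by linarith))] with n h1 h2
    refine lt_of_le_of_lt (mul_le_mul_of_nonneg_left (hH ?_) (Nat.cast_nonneg n)) h1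
    rw [div_lt_iff₀ (ha n)] at h2
    have := Nat.lt_floor_add_one (a n * y)
    linarith

/-- A positive monotone function `G` with `n * G (a n * y) → y ^ (-α)` along some `a n → ∞` is
regularly varying of index `-α`. -/
theorem regularlyVarying_of_sequence {G : ℝ → ℝ} (hG : Antitone G) {α : ℝ} {a : ℕ → ℝ} (hatop : Tendsto a atTop atTop)
    (hlim : ∀ y, 0 < y → Tendsto (fun n : ℕ => (n : ℝ) * G (a n * y)) atTop (𝓝 (y ^ (-α))))
    {y : ℝ} (hy : 0 < y) :
    Tendsto (fun t => G (t * y) / G t) atTop (𝓝 (y ^ (-α))) := by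
  have hex : ∀ t, ∃ n, t < a n := fun t => (hatop.eventually_gt_atTop t).exists
  classical
  -- `a (N t - 1) ≤ t < a (N t)`
  let N : ℝ → ℕ := fun t => Nat.find (hex t)
  have hN : Tendsto N atTop atTop := by
    refine tendsto_atTop.2 fun K => ?_
    filter_upwards [eventually_ge_atTop (∑ i ∈ Finset.range K, |a i|)] with t ht
    by_contra hc
    have h1 : t < a (N t) := Nat.find_spec (hex t)
    have h2 := Finset.single_le_sum (f := fun i => |a i|) (fun i _ => abs_nonneg (a i))
      (Finset.mem_range.2 (not_le.1 hc))
    have h3 := le_abs_self (a (N t))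
    linarith
  have main : ∀ y, 0 < y → Tendsto (fun t => (N t : ℝ) * G (t * y)) atTop (𝓝 (y ^ (-α))) := by
    intro y hy
    have hl := (hlim y hy).comp hN
    have hN1 : Tendsto (fun t => N t - 1) atTop atTop := (tendsto_sub_atTop_nat 1).comp hN
    have hu := (hlim y hy).comp hN1
    have hu0 : Tendsto (fun n : ℕ => G (a n * y)) atTop (𝓝 0) := by
      have := (hlim y hy).mul tendsto_inv_atTop_nhds_zero_nat
      rw [mul_zero] at this
      refine this.congr' ?_
      filter_upwards [eventually_ge_atTop 1] with n hn
      have : (n : ℝ) ≠ 0 := by positivity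
      field_simp
    have hu' := hu.add (hu0.comp hN1)
    rw [add_zero] at hu'
    refine tendsto_of_tendsto_of_tendsto_of_le_of_le' hl hu' ?_ ?_
    · refine Eventually.of_forall fun t => ?_
      exact mul_le_mul_of_nonneg_left
        (hG (mul_le_mul_of_nonneg_right (Nat.find_spec (hex t)).le hy.le)) (Nat.cast_nonneg _)
    · filter_upwards [tendsto_atTop.1 hN 1] with t ht
      have h1 : a (N t - 1) ≤ t := not_lt.1 (Nat.find_min (hex t) (m := N t - 1) (by
        change N t - 1 < N t; omega))
      have h2 := hG (mul_le_mul_of_nonneg_right h1 hy.le)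
      simp only [Function.comp]
      rw [Nat.cast_sub ht]
      have h3 := mul_le_mul_of_nonneg_left h2 (Nat.cast_nonneg (α := ℝ) (N t))
      push_cast
      linarith
  have h1 := main 1 one_pos
  rw [Real.one_rpow] at h1
  have := (main y hy).div h1 one_ne_zero
  rw [div_one] at this
  refine this.congr' ?_
  filter_upwards [tendsto_atTop.1 hN 1] with t ht
  have : (N t : ℝ) ≠ 0 := by positivity
  simp only [Pi.div_apply, mul_one]
  rw [mul_div_mul_left _ _ this]

/-! ### The envelope tail -/

theorem summable_tail_term {f : ℕ+ → ℝ} (hf : IsEnvelope f) (k : ℕ) :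
    Summable fun j : ℕ+ => if k < (j : ℕ) then f j else 0 := by
  refine Summable.of_nonneg_of_le (fun j => ?_) (fun j => ?_) hf.summable
  · split_ifs
    exacts [(hf.pos j).le, le_rfl]
  · split_ifs
    exacts [le_rfl, (hf.pos j).le]

theorem envelopeTail_antitone {f : ℕ+ → ℝ} (hf : IsEnvelope f) : Antitone (envelopeTail f) := by
  intro k l hkl
  refine (summable_tail_term hf l).tsum_le_tsum (fun j => ?_) (summable_tail_term hf k)
  have := (hf.pos j).le
  split_ifs with h1 h2
  · exact le_rfl
  · omega
  · exact this
  · exact le_rfl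

/-- A finite set of symbols beyond `k` has envelope mass at most the tail at `k`. -/
theorem sum_le_envelopeTail {f : ℕ+ → ℝ} (hf : IsEnvelope f) {k : ℕ} (s : Finset ℕ+)
    (hs : ∀ j ∈ s, k < (j : ℕ)) : ∑ j ∈ s, f j ≤ envelopeTail f k := by
  have h1 : ∑ j ∈ s, f j = ∑ j ∈ s, if k < (j : ℕ) then f j else 0 :=
    Finset.sum_congr rfl fun j hj => by rw [if_pos (hs j hj)]
  rw [h1]
  refine (summable_tail_term hf k).sum_le_tsum _ fun j _ => ?_
  split_ifs
  exacts [(hf.pos j).le, le_rfl]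

theorem envelopeTail_pos {f : ℕ+ → ℝ} (hf : IsEnvelope f) (k : ℕ) : 0 < envelopeTail f k := by
  have := sum_le_envelopeTail hf (k := k) {k.succPNat} (by simp)
  rw [Finset.sum_singleton] at this
  exact (hf.pos _).trans_le this

/-- The tail at `k` splits off the symbols in `(k, l]`. -/
theorem envelopeTail_eq_sum_add {f : ℕ+ → ℝ} (hf : IsEnvelope f) (k : ℕ) (s : Finset ℕ+) (l : ℕ)
    (hs : ∀ j : ℕ+, j ∈ s ↔ k < (j : ℕ) ∧ (j : ℕ) ≤ l) (hkl : k ≤ l) :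
    envelopeTail f k = ∑ j ∈ s, f j + envelopeTail f l := by
  have h1 : ∑ j ∈ s, f j = ∑' j, if j ∈ s then f j else 0 := by
    rw [tsum_eq_sum (s := s) (fun j hj => by rw [if_neg hj])]
    exact Finset.sum_congr rfl fun j hj => by rw [if_pos hj]
  rw [h1, envelopeTail, envelopeTail, ← Summable.tsum_add _ (summable_tail_term hf l)]
  · refine tsum_congr fun j => ?_
    simp only [hs]
    split_ifs <;> first | omega | simp
  · exact summable_of_ne_finset_zero (s := s) fun j hj => by rw [if_neg hj]

/-- The envelope tail as a function of a real variable. -/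
noncomputable def realTail (f : ℕ+ → ℝ) (t : ℝ) : ℝ := envelopeTail f ⌊t⌋₊

theorem realTail_antitone {f : ℕ+ → ℝ} (hf : IsEnvelope f) : Antitone (realTail f) :=
  fun _ _ h => envelopeTail_antitone hf (Nat.floor_mono h)

theorem realTail_pos {f : ℕ+ → ℝ} (hf : IsEnvelope f) (t : ℝ) : 0 < realTail f t :=
  envelopeTail_pos hf _

theorem IsSmoothedEnvelopeCDF.nonneg {f : ℕ+ → ℝ} {F : ℝ → ℝ} (hF : IsSmoothedEnvelopeCDF f F)
    (x : ℝ) : 0 ≤ F x := by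
  have h := hF.eq_zero_of_neg (min x (-1)) (by
    have := min_le_right x (-1)
    linarith)
  rw [← h]
  exact hF.mono (min_le_left _ _)

theorem IsSmoothedEnvelopeCDF.lt_one {f : ℕ+ → ℝ} (hf : IsEnvelope f) {F : ℝ → ℝ}
    (hF : IsSmoothedEnvelopeCDF f F) (x : ℝ) : F x < 1 := by
  refine (hF.mono (Nat.le_ceil x)).trans_lt ?_
  rw [hF.eq_on_nat, envelopeCDF]
  have := envelopeTail_pos hf ⌈x⌉₊
  split_ifs <;> linarith

theorem IsSmoothedEnvelopeCDF.eventually_tail {f : ℕ+ → ℝ} {F : ℝ → ℝ}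
    (hF : IsSmoothedEnvelopeCDF f F) : ∀ᶠ t : ℝ in atTop, 1 - F ⌊t⌋₊ = realTail f t := by
  have h1 : Tendsto (fun t : ℝ => F ⌊t⌋₊) atTop (𝓝 1) :=
    hF.tendsto_one.comp (tendsto_natCast_atTop_atTop.comp tendsto_nat_floor_atTop)
  filter_upwards [h1.eventually (lt_mem_nhds one_pos)] with t ht
  rw [hF.eq_on_nat, envelopeCDF] at *
  rw [realTail]
  split_ifs at * with h
  · ring
  · exact absurd ht (lt_irrefl _)

/-- If a smoothed envelope distribution function is in `MDA(γ)` with `γ > 0`, the envelope tail is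
regularly varying of index `-1/γ`. -/
theorem realTail_regularlyVarying {f : ℕ+ → ℝ} {F : ℝ → ℝ} {γ : ℝ} (hf : IsEnvelope f)
    (hF : IsSmoothedEnvelopeCDF f F) (hγ : 0 < γ) (hMDA : InMDA γ F) {y : ℝ} (hy : 0 < y) :
    Tendsto (fun t => realTail f (t * y) / realTail f t) atTop (𝓝 (y ^ (-(1 / γ)))) := by
  obtain ⟨A, hA, hlim⟩ := hMDA
  have hH : Antitone fun x => 1 - F x := fun x y h => by
    have := hF.mono h
    simp only
    linarith
  have hpos : ∀ x, 0 < 1 - F x := fun x => by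
    have := hF.lt_one hf x
    linarith
  have ha : ∀ n, 0 < A n / γ := fun n => div_pos (hA n) hγ
  have hlim' : ∀ z, 0 < z → Tendsto (fun n : ℕ => (n : ℝ) *
      (1 - F ((tailQuantile F n - A n / γ) + A n / γ * z))) atTop (𝓝 (z ^ (-(1 / γ)))) := by
    intro z hz
    refine tendsto_mul_one_sub_of_pow (fun n => hF.nonneg _) ?_
    -- the extremal limit at `x = (z - 1) / γ`
    have h1 : 1 + γ * ((z - 1) / γ) = z := by field_simp; ring
    have := hlim ((z - 1) / γ) (by rw [h1]; exact hz.le)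
    rw [gev, if_neg hγ.ne', h1, if_pos hz, ← neg_div] at *
    refine this.congr fun n => ?_
    congr 2
    field_simp
    ring
  have hα : 0 < 1 / γ := by positivity
  obtain ⟨hatop, -⟩ := tendsto_scale_atTop hH hpos hα ha hlim'
  refine regularlyVarying_of_sequence (realTail_antitone hf) hatop
    (fun y hy => ?_) hy
  have h1 := tendsto_mul_floor hH hpos hα ha hlim' hy
  have h2 := (hatop.atTop_mul_const hy).eventually hF.eventually_tail
  refine h1.congr' ?_
  filter_upwards [h2] with n hn
  rw [← hn]

/-! ### The effective alphabet size -/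

/-- The largest `t` with `t ≤ s * G t`. For `G` the envelope tail, a message of length `s` is expected
to have up to about `t` symbols larger than `t`. The set is empty when `s < 0`, and the value is then
zero. -/
noncomputable def effectiveSize (G : ℝ → ℝ) (s : ℝ) : ℝ := sSup {t : ℝ | 0 ≤ t ∧ t ≤ s * G t}

section effectiveSize

variable {G : ℝ → ℝ}

theorem bddAbove_effectiveSize (hG : Antitone G) (hpos : ∀ x, 0 < G x) (s : ℝ) :
    BddAbove {t : ℝ | 0 ≤ t ∧ t ≤ s * G t} := by
  refine ⟨|s| * G 0, fun t ht => ht.2.trans ?_⟩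
  exact mul_le_mul (le_abs_self s) (hG ht.1) (hpos t).le (abs_nonneg s)

theorem le_effectiveSize (hG : Antitone G) (hpos : ∀ x, 0 < G x) {s t : ℝ} (h0 : 0 ≤ t)
    (h : t ≤ s * G t) : t ≤ effectiveSize G s :=
  le_csSup (bddAbove_effectiveSize hG hpos s) ⟨h0, h⟩

theorem effectiveSize_nonneg (s : ℝ) : 0 ≤ effectiveSize G s := Real.sSup_nonneg fun _ h => h.1

theorem mul_lt_of_effectiveSize_lt (hG : Antitone G) (hpos : ∀ x, 0 < G x) {s t : ℝ}
    (h : effectiveSize G s < t) : s * G t < t := by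
  by_contra hc
  exact absurd (le_effectiveSize hG hpos ((effectiveSize_nonneg s).trans h.le) (not_lt.1 hc))
    (not_le.2 h)

theorem le_mul_of_lt_effectiveSize (hG : Antitone G) {s t : ℝ} (hs : 0 ≤ s) (ht : 0 ≤ t)
    (h : t < effectiveSize G s) : t ≤ s * G t := by
  have hne : {t : ℝ | 0 ≤ t ∧ t ≤ s * G t}.Nonempty := by
    by_contra hc
    rw [Set.not_nonempty_iff_eq_empty] at hc
    rw [effectiveSize, hc, Real.sSup_empty] at h
    linarith
  obtain ⟨u, hu, htu⟩ := exists_lt_of_lt_csSup hne h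
  exact htu.le.trans (hu.2.trans (mul_le_mul_of_nonneg_left (hG htu.le) hs))

theorem effectiveSize_le (hG : Antitone G) {s y : ℝ} (hs : 0 ≤ s) (hy : 0 ≤ y)
    (h : s * G y < y) : effectiveSize G s ≤ y := by
  by_contra hc
  exact absurd (le_mul_of_lt_effectiveSize hG hs hy (not_le.1 hc)) (not_le.2 h)

theorem effectiveSize_mono (hG : Antitone G) (hpos : ∀ x, 0 < G x) : Monotone (effectiveSize G) := by
  intro s s' h
  refine Real.sSup_le (fun t ht => le_effectiveSize hG hpos ht.1 (ht.2.trans ?_))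
    (effectiveSize_nonneg s')
  exact mul_le_mul_of_nonneg_right h (hpos t).le

theorem effectiveSize_pos (hG : Antitone G) (hpos : ∀ x, 0 < G x) {s : ℝ} (hs : 0 < s) :
    0 < effectiveSize G s := by
  have h0 : 0 < min 1 (s * G 1) := lt_min one_pos (mul_pos hs (hpos 1))
  refine h0.trans_le (le_effectiveSize hG hpos h0.le ?_)
  exact (min_le_right _ _).trans (mul_le_mul_of_nonneg_left (hG (min_le_left _ _)) hs.le)

theorem effectiveSize_le_mul (hG : Antitone G) (hpos : ∀ x, 0 < G x) {s : ℝ} (hs : 0 ≤ s) :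
    effectiveSize G s ≤ s * G 0 :=
  Real.sSup_le (fun _ ht => ht.2.trans (mul_le_mul_of_nonneg_left (hG ht.1) hs))
    (mul_nonneg hs (hpos 0).le)

theorem tendsto_effectiveSize (hG : Antitone G) (hpos : ∀ x, 0 < G x) :
    Tendsto (effectiveSize G) atTop atTop := by
  refine tendsto_atTop.2 fun b => ?_
  filter_upwards [eventually_ge_atTop (max b 0 / G (max b 0))] with s hs
  rw [div_le_iff₀ (hpos _)] at hs
  exact (le_max_left b 0).trans (le_effectiveSize hG hpos (le_max_right _ _) hs)

/-- The upper half of regular variation; the lower half is this one at `x⁻¹`. -/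
theorem eventually_effectiveSize_mul_le (hG : Antitone G) (hpos : ∀ x, 0 < G x) {α : ℝ}
    (hα : 0 < α)
    (hRV : ∀ y, 0 < y → Tendsto (fun t => G (t * y) / G t) atTop (𝓝 (y ^ (-α))))
    {x y : ℝ} (hx : 0 < x) (hxy : x ^ (1 / (1 + α)) < y) :
    ∀ᶠ s in atTop, effectiveSize G (s * x) ≤ y * effectiveSize G s := by
  have hy : 0 < y := (Real.rpow_pos_of_pos hx _).trans hxy
  have h1 : x * y ^ (-α) < y := by
    have h2 : x < y ^ (1 + α) := by
      have := Real.rpow_lt_rpow (by positivity) hxy (show 0 < 1 + α by linarith)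
      rwa [← Real.rpow_mul hx.le, one_div, inv_mul_cancel₀ (by linarith), Real.rpow_one] at this
    calc x * y ^ (-α) < y ^ (1 + α) * y ^ (-α) :=
          mul_lt_mul_of_pos_right h2 (Real.rpow_pos_of_pos hy _)
      _ = y := by rw [← Real.rpow_add hy]; simp
  -- room for evaluating the tail slightly beyond the effective size
  obtain ⟨v, hv1, hv⟩ : ∃ v : ℝ, 1 < v ∧ x * v * (y / v) ^ (-α) < y := by
    have hc : ContinuousAt (fun v : ℝ => x * v * (y / v) ^ (-α)) 1 := by
      refine ContinuousAt.mul (by fun_prop) (ContinuousAt.rpow_const ?_ (Or.inl (by simpa using hy.ne')))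
      exact continuousAt_const.div continuousAt_id one_ne_zero
    have h3 := (hc.eventually (gt_mem_nhds (show x * 1 * (y / 1) ^ (-α) < y by simpa using h1))
      ).filter_mono (nhdsWithin_le_nhds (s := Set.Ioi 1))
    obtain ⟨v, hv, hv2⟩ := (h3.and self_mem_nhdsWithin).exists
    exact ⟨v, hv2, hv⟩
  have hv0 : 0 < v := one_pos.trans hv1
  have h4 := ((hRV (y / v) (div_pos hy hv0)).const_mul (x * v)).eventually (gt_mem_nhds hv)
  have h5 := ((tendsto_effectiveSize hG hpos).const_mul_atTop hv0).eventually h4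
  filter_upwards [h5, eventually_gt_atTop 0] with s h6 hs
  set τ := effectiveSize G s with hτ
  have hτ0 : 0 < τ := effectiveSize_pos hG hpos hs
  have h7 := mul_lt_of_effectiveSize_lt hG hpos (s := s) (t := v * τ)
    (by rw [← hτ]; nlinarith)
  refine effectiveSize_le hG (mul_pos hs hx).le (mul_pos hy hτ0).le ?_
  rw [show v * τ * (y / v) = y * τ by field_simp] at h6
  rw [← mul_div_assoc, div_lt_iff₀ (hpos _)] at h6
  have h8 : v * (s * x * G (y * τ)) < v * (y * τ) := by
    calc v * (s * x * G (y * τ)) = s * (x * v * G (y * τ)) := by ring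
      _ < s * (y * G (v * τ)) := mul_lt_mul_of_pos_left h6 hs
      _ = y * (s * G (v * τ)) := by ring
      _ < y * (v * τ) := mul_lt_mul_of_pos_left h7 hy
      _ = v * (y * τ) := by ring
  exact lt_of_mul_lt_mul_left h8 hv0.le

/-- The effective alphabet size is regularly varying of index `1/(1+α)`. -/
theorem effectiveSize_regularlyVarying (hG : Antitone G) (hpos : ∀ x, 0 < G x) {α : ℝ}
    (hα : 0 < α)
    (hRV : ∀ y, 0 < y → Tendsto (fun t => G (t * y) / G t) atTop (𝓝 (y ^ (-α))))
    {x : ℝ} (hx : 0 < x) :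
    Tendsto (fun s => effectiveSize G (s * x) / effectiveSize G s) atTop
      (𝓝 (x ^ (1 / (1 + α)))) := by
  have hxr := Real.rpow_pos_of_pos hx (1 / (1 + α))
  refine tendsto_order.2 ⟨fun b hb => ?_, fun b hb => ?_⟩
  · obtain ⟨y, hby, hy⟩ := exists_between (max_lt hb hxr)
    have hy0 : 0 < y := (le_max_right b 0).trans_lt hby
    have h1 : x⁻¹ ^ (1 / (1 + α)) < y⁻¹ := by
      rw [Real.inv_rpow hx.le]
      exact inv_strictAnti₀ hy0 hy
    have h2 := (tendsto_id.atTop_mul_const hx).eventually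
      (eventually_effectiveSize_mul_le hG hpos hα hRV (inv_pos.2 hx) h1)
    filter_upwards [h2, eventually_gt_atTop 0] with s hs hs0
    have hT := effectiveSize_pos hG hpos hs0
    rw [id, mul_inv_cancel_right₀ hx.ne', inv_mul_eq_div, le_div_iff₀ hy0] at hs
    rw [lt_div_iff₀ hT]
    refine lt_of_lt_of_le ?_ hs
    rw [mul_comm]
    exact mul_lt_mul_of_pos_left ((le_max_left b 0).trans_lt hby) hT
  · obtain ⟨y, hy, hyb⟩ := exists_between hb
    filter_upwards [eventually_effectiveSize_mul_le hG hpos hα hRV hx hy, eventually_gt_atTop 0]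
      with s hs hs0
    exact ((div_le_iff₀ (effectiveSize_pos hG hpos hs0)).2 hs).trans_lt hyb

end effectiveSize

theorem tendsto_natCast_half {T : ℝ → ℝ} {l : ℝ}
    (h : Tendsto (fun s => T (s * (1 / 2)) / T s) atTop (𝓝 l)) :
    Tendsto (fun n : ℕ => T ((n : ℝ) * (1 / 2)) / T n) atTop (𝓝 l) :=
  h.comp tendsto_natCast_atTop_atTop

/-- A sum of `T i / i` over `i ≤ n` is of the order of its last dyadic block, because `T` has a
positive index of regular variation. -/
theorem sum_div_le {T : ℝ → ℝ} (hT : Monotone T) (hpos : ∀ s, 0 < s → 0 < T s)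
    (hnn : ∀ s, 0 ≤ T s) {l : ℝ} (hl : l < 1)
    (h : Tendsto (fun s => T (s * (1 / 2)) / T s) atTop (𝓝 l)) :
    ∃ B, 0 < B ∧ ∀ n : ℕ, 1 ≤ n →
      ∑ i ∈ Finset.range n, T ((i + 1 : ℕ) : ℝ) / ((i + 1 : ℕ) : ℝ) ≤ B * T n := by
  set S : ℕ → ℝ := fun n => ∑ i ∈ Finset.range n, T ((i + 1 : ℕ) : ℝ) / ((i + 1 : ℕ) : ℝ) with hS
  have hterm : ∀ i : ℕ, 0 ≤ T ((i + 1 : ℕ) : ℝ) / ((i + 1 : ℕ) : ℝ) := fun i =>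
    div_nonneg (hnn _) (Nat.cast_nonneg _)
  obtain ⟨c, hlc, hc⟩ := exists_between hl
  obtain ⟨C, hC⟩ := abs_le_const_add_mul_of_halving (a := fun n : ℕ => T n) (W := S) (c := c)
    (δ := 1) (fun n => hnn n) hc zero_le_one (by
      filter_upwards [(tendsto_natCast_half h).eventually (gt_mem_nhds hlc), eventually_ge_atTop 1]
        with n hn hn1
      have hn0 : (0 : ℝ) < n := by exact_mod_cast hn1
      constructor
      · rw [div_lt_iff₀ (hpos _ hn0)] at hn
        refine (hT ?_).trans hn.le
        have := Nat.cast_div_le (α := ℝ) (m := n) (n := 2)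
        push_cast at this
        linarith
      · have h1 : S n - S (n / 2)
            = ∑ i ∈ Finset.Ico (n / 2) n, T ((i + 1 : ℕ) : ℝ) / ((i + 1 : ℕ) : ℝ) := by
          rw [Finset.sum_Ico_eq_sub _ (Nat.div_le_self n 2)]
        rw [abs_sub_comm, h1, abs_of_nonneg (Finset.sum_nonneg fun i _ => hterm i), one_mul]
        have h2 : ∀ i ∈ Finset.Ico (n / 2) n, T ((i + 1 : ℕ) : ℝ) / ((i + 1 : ℕ) : ℝ)
            ≤ T n / ((n / 2 + 1 : ℕ) : ℝ) := by
          intro i hi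
          rw [Finset.mem_Ico] at hi
          refine div_le_div₀ (hnn _) (hT ?_) (by positivity) ?_
          · exact_mod_cast hi.2
          · exact_mod_cast Nat.succ_le_succ hi.1
        refine (Finset.sum_le_sum h2).trans ?_
        rw [Finset.sum_const, Nat.card_Ico, nsmul_eq_mul, ← mul_div_assoc,
          div_le_iff₀ (by positivity), mul_comm]
        refine mul_le_mul_of_nonneg_left ?_ (hnn _)
        exact_mod_cast (by omega : n - n / 2 ≤ n / 2 + 1))
  have hT1 : 0 < T 1 := hpos 1 one_pos
  have hC0 : 0 ≤ 1 / (1 - c) := div_nonneg zero_le_one (by linarith)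
  refine ⟨|C| / T 1 + 1 / (1 - c) + 1, by positivity, fun n hn => ?_⟩
  have h1 := (le_abs_self _).trans (hC n)
  have h2 : |C| ≤ |C| / T 1 * T n := by
    rw [div_mul_eq_mul_div, le_div_iff₀ hT1]
    exact mul_le_mul_of_nonneg_left (hT (by exact_mod_cast hn)) (abs_nonneg C)
  have h3 := le_abs_self C
  have h4 := hnn n
  simp only [hS] at h1
  nlinarith

/-- A monotone regularly varying sequence of index `ρ` grows like `n ^ (ρ + o(1))`. -/
theorem tendsto_log_div_log {T : ℝ → ℝ} (hT : Monotone T) (hpos : ∀ s, 0 < s → 0 < T s)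
    {ρ : ℝ} (h : Tendsto (fun s => T (s * 2) / T s) atTop (𝓝 (2 ^ ρ))) :
    Tendsto (fun n : ℕ => Real.log (T n) / Real.log n) atTop (𝓝 ρ) := by
  have hl2 : 0 < Real.log 2 := Real.log_pos (by norm_num)
  have hp2 : ∀ k : ℕ, 0 < T ((2 : ℝ) ^ k) := fun k => hpos _ (by positivity)
  have h1 : Tendsto (fun k : ℕ => Real.log (T (2 ^ (k + 1))) - Real.log (T (2 ^ k))) atTop
      (𝓝 (ρ * Real.log 2)) := by
    have h2 := ((h.comp (tendsto_pow_atTop_atTop_of_one_lt (by norm_num : (1 : ℝ) < 2)))).log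
      (Real.rpow_pos_of_pos two_pos ρ).ne'
    rw [Real.log_rpow two_pos] at h2
    refine h2.congr fun k => ?_
    simp only [Function.comp]
    rw [Real.log_div (hpos _ (by positivity)).ne' (hp2 k).ne', pow_succ]
  have h3 : Tendsto (fun k : ℕ => Real.log (T (2 ^ k)) / k) atTop (𝓝 (ρ * Real.log 2)) := by
    have h4 := h1.cesaro
    have h5 : Tendsto (fun k : ℕ => Real.log (T 1) * (k : ℝ)⁻¹) atTop (𝓝 0) := by
      simpa using tendsto_inv_atTop_nhds_zero_nat.const_mul (Real.log (T 1))
    have h6 := h4.add h5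
    rw [add_zero] at h6
    refine h6.congr fun k => ?_
    rw [Finset.sum_range_sub (fun k : ℕ => Real.log (T (2 ^ k))), pow_zero]
    ring
  have hk : Tendsto (fun n : ℕ => Nat.log 2 n) atTop atTop := by
    refine tendsto_atTop.2 fun K => ?_
    filter_upwards [eventually_ge_atTop (2 ^ K)] with n hn
    exact Nat.le_log_of_pow_le (by norm_num) hn
  have hcr : Tendsto (fun k : ℕ => ((k + 1 : ℕ) : ℝ) / k) atTop (𝓝 1) := by
    have := tendsto_inv_atTop_nhds_zero_nat (𝕜 := ℝ)
    have h2 := this.const_add 1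
    rw [add_zero] at h2
    refine h2.congr' ?_
    filter_upwards [eventually_ge_atTop 1] with k hk
    have : (k : ℝ) ≠ 0 := by positivity
    push_cast
    field_simp
  have h3' : Tendsto (fun k : ℕ => Real.log (T (2 ^ (k + 1))) / k) atTop (𝓝 (ρ * Real.log 2)) := by
    have h7 := ((tendsto_add_atTop_iff_nat 1).2 h3).mul hcr
    rw [mul_one] at h7
    refine h7.congr' ?_
    filter_upwards [eventually_ge_atTop 1] with k hk
    have : (k : ℝ) ≠ 0 := by positivity
    field_simp
  have hpow : ∀ n : ℕ, 1 ≤ n → (2 : ℝ) ^ Nat.log 2 n ≤ n ∧ (n : ℝ) ≤ 2 ^ (Nat.log 2 n + 1) := by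
    intro n hn
    exact ⟨by exact_mod_cast Nat.pow_log_le_self 2 (by omega),
      by exact_mod_cast (Nat.lt_pow_succ_log_self (by norm_num) n).le⟩
  have h8 : Tendsto (fun n : ℕ => Real.log (T n) / (Nat.log 2 n : ℕ)) atTop
      (𝓝 (ρ * Real.log 2)) := by
    refine tendsto_of_tendsto_of_tendsto_of_le_of_le' (h3.comp hk) (h3'.comp hk) ?_ ?_
    · filter_upwards [eventually_ge_atTop 1] with n hn
      exact div_le_div_of_nonneg_right (Real.log_le_log (hp2 _) (hT (hpow n hn).1))
        (Nat.cast_nonneg _)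
    · filter_upwards [eventually_ge_atTop 1] with n hn
      exact div_le_div_of_nonneg_right (Real.log_le_log (hpos _ (by exact_mod_cast hn))
        (hT (hpow n hn).2)) (Nat.cast_nonneg _)
  have h9 : Tendsto (fun n : ℕ => Real.log n / (Nat.log 2 n : ℕ)) atTop (𝓝 (Real.log 2)) := by
    have h10 : Tendsto (fun k : ℕ => ((k + 1 : ℕ) : ℝ) / k * Real.log 2) atTop
        (𝓝 (Real.log 2)) := by simpa using hcr.mul_const (Real.log 2)
    refine tendsto_of_tendsto_of_tendsto_of_le_of_le' tendsto_const_nhds (h10.comp hk) ?_ ?_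
    · filter_upwards [eventually_ge_atTop 1, tendsto_atTop.1 hk 1] with n hn hn2
      rw [le_div_iff₀ (by exact_mod_cast hn2), mul_comm, ← Real.log_pow]
      exact Real.log_le_log (by positivity) (hpow n hn).1
    · filter_upwards [eventually_ge_atTop 1] with n hn
      simp only [Function.comp]
      rw [div_mul_eq_mul_div, ← Real.log_pow]
      exact div_le_div_of_nonneg_right (Real.log_le_log (by exact_mod_cast hn) (hpow n hn).2)
        (Nat.cast_nonneg _)
  have := h8.div h9 hl2.ne'
  rw [mul_div_cancel_right₀ _ hl2.ne'] at this
  refine this.congr' ?_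
  filter_upwards [tendsto_atTop.1 hk 1] with n hn
  have : ((Nat.log 2 n : ℕ) : ℝ) ≠ 0 := by positivity
  simp only [Pi.div_apply]
  rw [div_div_div_cancel_right₀ this]

/-! ### A lower bound for the minimax redundancy -/

instance instDiscretePNat : DiscreteMeasurableSpace ℕ+ := ⟨fun _ => trivial⟩

instance instIsProbabilityMeasureBlockLaw (P : PMF ℕ+) (n : ℕ) :
    IsProbabilityMeasure (blockLaw P n) := by
  unfold blockLaw; infer_instance

/-- Linearized Donsker-Varadhan inequality: it follows from `t * log g + 1 ≤ klFun t + g`,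
evaluated at the density `t`. -/
theorem lintegral_log_add_one_le {α : Type*} [MeasurableSpace α] (μ ν : Measure α)
    [IsProbabilityMeasure μ] [IsProbabilityMeasure ν] {g : α → ℝ} (hg : Measurable g)
    (h1 : ∀ᵐ x ∂μ, 1 ≤ g x) :
    ∫⁻ x, ENNReal.ofReal (Real.log (g x)) ∂μ + 1
      ≤ InformationTheory.klDiv μ ν + ∫⁻ x, ENNReal.ofReal (g x) ∂ν := by
  by_cases hac : μ ≪ ν
  swap
  · rw [InformationTheory.klDiv_of_not_ac hac]; simp
  rw [InformationTheory.klDiv_eq_lintegral_klFun_of_ac hac,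
    ← lintegral_rnDeriv_mul hac (hg.log.ennreal_ofReal.aemeasurable)]
  have hone : (1 : ℝ≥0∞) = ∫⁻ _, 1 ∂ν := by simp
  rw [hone, ← lintegral_add_right _ measurable_const,
    ← lintegral_add_right _ hg.ennreal_ofReal]
  refine lintegral_mono_ae ?_
  filter_upwards [Measure.ae_rnDeriv_ne_zero_imp_of_ae (ν := ν) h1, Measure.rnDeriv_lt_top μ ν]
    with x hx hx2
  set t := (μ.rnDeriv ν x).toReal with ht
  have ht0 : 0 ≤ t := ENNReal.toReal_nonneg
  have htr : μ.rnDeriv ν x = ENNReal.ofReal t := (ENNReal.ofReal_toReal hx2.ne).symm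
  by_cases h0 : μ.rnDeriv ν x = 0
  · have : t = 0 := by rw [ht, h0]; simp
    rw [h0, this, InformationTheory.klFun_zero]
    simp
  · have hgx := hx h0
    have hg0 : 0 < g x := by linarith
    have htp : 0 < t := ENNReal.toReal_pos h0 hx2.ne
    rw [htr, ← ENNReal.ofReal_mul ht0, ← ENNReal.ofReal_one,
      ← ENNReal.ofReal_add (mul_nonneg ht0 (Real.log_nonneg hgx)) zero_le_one,
      ← ENNReal.ofReal_add (InformationTheory.klFun_nonneg ht0) hg0.le]
    refine ENNReal.ofReal_le_ofReal ?_
    have h2 := InformationTheory.klFun_nonneg (div_pos htp hg0).le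
    have h3 : g x * InformationTheory.klFun (t / g x) = t * (Real.log t - Real.log (g x)) + g x - t := by
      rw [InformationTheory.klFun_apply, Real.log_div htp.ne' hg0.ne']
      field_simp
    have h4 := mul_nonneg hg0.le h2
    rw [h3] at h4
    rw [InformationTheory.klFun_apply]
    linarith

theorem blockLaw_eval (P : PMF ℕ+) {n : ℕ} (i : Fin n) (s : Set ℕ+) :
    blockLaw P n {x | x i ∈ s} = P.toMeasure s :=
  (measurePreserving_eval (fun _ : Fin n => P.toMeasure) i).measure_preimage
    (MeasurableSet.of_discrete.nullMeasurableSet)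

theorem blockLaw_exists_eq (P : PMF ℕ+) (n : ℕ) (a : ℕ+) :
    blockLaw P n {x | ∃ i, x i = a} = 1 - (1 - P a) ^ n := by
  have h1 : {x : Fin n → ℕ+ | ∃ i, x i = a}ᶜ = Set.univ.pi fun _ => {a}ᶜ := by
    ext x; simp
  have h2 := prob_compl_eq_one_sub (μ := blockLaw P n)
    (s := {x : Fin n → ℕ+ | ∃ i, x i = a}ᶜ) MeasurableSet.of_discrete
  rw [compl_compl] at h2
  rw [h2, h1, blockLaw, Measure.pi_pi]
  simp [prob_compl_eq_one_sub (μ := P.toMeasure) (MeasurableSet.singleton a),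
    PMF.toMeasure_apply_singleton _ _ (MeasurableSet.singleton a)]

/-- The likelihood factor contributed by a pair of symbols `(a, a')`, of which only `a` is used by
the source, with respect to the uniform mixture over which one is used. -/
noncomputable def pairFactor {n : ℕ} (a a' : ℕ+) (x : Fin n → ℕ+) : ℝ :=
  open Classical in if ∃ i, x i = a' then 0 else if ∃ i, x i = a then 2 else 1

theorem pairFactor_nonneg {n : ℕ} (a a' : ℕ+) (x : Fin n → ℕ+) : 0 ≤ pairFactor a a' x := by
  unfold pairFactor; split_ifs <;> norm_num

theorem pairFactor_add_le {n : ℕ} (a a' : ℕ+) (x : Fin n → ℕ+) :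
    pairFactor a a' x + pairFactor a' a x ≤ 2 := by
  unfold pairFactor; split_ifs <;> norm_num

/-- If the class contains all sources that use exactly one symbol of each of `m` disjoint pairs,
that symbol having probability `p`, then coding reveals about one bit for every pair seen. -/
theorem le_maximalRedundancy_of_pairs {m n : ℕ} {Λ : Set (PMF ℕ+)} {p : ℝ} (hp0 : 0 ≤ p)
    (hp1 : p ≤ 1) (s : Fin m → Bool → ℕ+) (P : (Fin m → Bool) → PMF ℕ+) (hP : ∀ θ, P θ ∈ Λ)
    (h1 : ∀ θ j, P θ (s j (θ j)) = ENNReal.ofReal p) (h2 : ∀ θ j, P θ (s j (!θ j)) = 0)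
    (Q : PMF (Fin n → ℕ+)) :
    ENNReal.ofReal (m * (1 - (1 - p) ^ n)) ≤ maximalRedundancy Q Λ := by
  set g : (Fin m → Bool) → (Fin n → ℕ+) → ℝ :=
    fun θ x => ∏ j, pairFactor (s j (θ j)) (s j (!θ j)) x with hg
  have hg0 : ∀ θ x, 0 ≤ g θ x := fun θ x => Finset.prod_nonneg fun j _ => pairFactor_nonneg _ _ _
  have hsum : ∀ x, ∑ θ, g θ x ≤ 2 ^ m := by
    intro x
    have e := Finset.prod_univ_sum (fun _ : Fin m => (Finset.univ : Finset Bool))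
      (fun j b => pairFactor (s j b) (s j (!b)) x)
    rw [Fintype.piFinset_univ] at e
    rw [← e]
    calc _ ≤ ∏ _j : Fin m, (2 : ℝ) := by
          refine Finset.prod_le_prod
            (fun j _ => Finset.sum_nonneg fun b _ => pairFactor_nonneg _ _ _) fun j _ => ?_
          simpa using pairFactor_add_le (s j true) (s j false) x
      _ = 2 ^ m := by simp
  -- the likelihood ratios average to at most one over `θ`, so one of them has `Q`-mean at most one
  obtain ⟨θ, -, hθ⟩ : ∃ θ ∈ (Finset.univ : Finset (Fin m → Bool)),
      ∫⁻ x, ENNReal.ofReal (g θ x) ∂Q.toMeasure ≤ 1 := by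
    by_contra! hcon
    refine absurd (ENNReal.sum_lt_sum_of_nonempty Finset.univ_nonempty hcon) (not_lt.2 ?_)
    rw [← lintegral_finsetSum _ (fun θ _ => Measurable.of_discrete)]
    calc _ ≤ ∫⁻ _, (2 : ℝ≥0∞) ^ m ∂Q.toMeasure := by
          refine lintegral_mono fun x => ?_
          rw [← ENNReal.ofReal_sum_of_nonneg fun θ _ => hg0 θ x]
          refine (ENNReal.ofReal_le_ofReal (hsum x)).trans ?_
          rw [ENNReal.ofReal_pow zero_le_two]; simp
      _ = _ := by simp
  refine le_trans ?_ (le_iSup₂_of_le (P θ) (hP θ) le_rfl)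
  have hae : ∀ᵐ x ∂blockLaw (P θ) n, ∀ j, ¬ ∃ i, x i = s j (!θ j) := by
    refine ae_all_iff.2 fun j => ?_
    rw [ae_iff]
    simp only [not_not]
    rw [blockLaw_exists_eq, h2]
    simp
  have hgae : ∀ᵐ x ∂blockLaw (P θ) n, g θ x =
      ∏ j, open Classical in if ∃ i, x i = s j (θ j) then (2 : ℝ) else 1 := by
    filter_upwards [hae] with x hx
    refine Finset.prod_congr rfl fun j _ => ?_
    rw [pairFactor, if_neg (hx j)]
  have hlog := lintegral_log_add_one_le (blockLaw (P θ) n) Q.toMeasure (g := g θ)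
    Measurable.of_discrete (by
      filter_upwards [hgae] with x hx
      rw [hx]
      refine Finset.one_le_prod fun j => ?_
      split_ifs <;> norm_num)
  have hlog2 := hlog.trans (add_le_add_right hθ _)
  rw [ENNReal.add_le_add_iff_right ENNReal.one_ne_top] at hlog2
  have hl2 : 0 < Real.log 2 := Real.log_pos (by norm_num)
  have hint : ∫⁻ x, ENNReal.ofReal (Real.log (g θ x)) ∂blockLaw (P θ) n
      = ENNReal.ofReal (m * (1 - (1 - p) ^ n)) * ENNReal.ofReal (Real.log 2) := by
    have e1 : ∫⁻ x, ENNReal.ofReal (Real.log (g θ x)) ∂blockLaw (P θ) n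
        = ∫⁻ x, ∑ j, ENNReal.ofReal (Real.log 2) *
            {x : Fin n → ℕ+ | ∃ i, x i = s j (θ j)}.indicator 1 x ∂blockLaw (P θ) n := by
      refine lintegral_congr_ae ?_
      filter_upwards [hgae] with x hx
      rw [hx, Real.log_prod (fun j _ => by split_ifs <;> norm_num),
        ENNReal.ofReal_sum_of_nonneg (fun j _ => Real.log_nonneg (by split_ifs <;> norm_num))]
      refine Finset.sum_congr rfl fun j _ => ?_
      by_cases h : ∃ i, x i = s j (θ j) <;> simp [h]
    have hpow : (1 - p) ^ n ≤ 1 := pow_le_one₀ (by linarith) (by linarith)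
    have e2 : ∀ j, blockLaw (P θ) n {x : Fin n → ℕ+ | ∃ i, x i = s j (θ j)}
        = ENNReal.ofReal (1 - (1 - p) ^ n) := by
      intro j
      rw [blockLaw_exists_eq, h1, ENNReal.ofReal_sub _ (pow_nonneg (by linarith) n),
        ENNReal.ofReal_pow (by linarith), ENNReal.ofReal_sub _ hp0, ENNReal.ofReal_one]
    rw [e1, lintegral_finsetSum _ (fun θ _ => Measurable.of_discrete)]
    simp_rw [lintegral_const_mul _ (Measurable.of_discrete),
      lintegral_indicator_one (MeasurableSet.of_discrete), e2]
    rw [Finset.sum_const, Finset.card_univ, Fintype.card_fin, nsmul_eq_mul,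
      ENNReal.ofReal_mul (Nat.cast_nonneg m), ENNReal.ofReal_natCast]
    ring
  rw [hint] at hlog2
  rw [klBits, ENNReal.le_div_iff_mul_le (Or.inl (by simpa using hl2))
    (Or.inl ENNReal.ofReal_ne_top)]
  exact hlog2

/-- A source in the envelope class that gives probability `p` to prescribed symbols, has the rest of
its mass on the symbols up to `j₀`, and charges nothing else. -/
theorem exists_source {f : ℕ+ → ℝ} (hf : IsEnvelope f) {j₀ : ℕ+}
    (hj₀ : 1 ≤ ∑ j ∈ Finset.Iic j₀, f j) {p : ℝ} (hp : 0 ≤ p) (t : Finset ℕ+)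
    (ht : ∀ j ∈ t, j₀ < j ∧ p ≤ f j) (hpt : t.card * p ≤ 1) :
    ∃ P ∈ envelopeClass f, (∀ j ∈ t, P j = ENNReal.ofReal p) ∧
      ∀ j, j₀ < j → j ∉ t → P j = 0 := by
  set S := ∑ j ∈ Finset.Iic j₀, f j with hS
  have hS0 : 0 < S := by linarith
  set w : ℕ+ → ℝ := fun j => if j ≤ j₀ then (1 - t.card * p) * (f j / S)
    else if j ∈ t then p else 0 with hw
  have hw0 : ∀ j, 0 ≤ w j := by
    intro j
    simp only [hw]
    split_ifs
    · exact mul_nonneg (by linarith) (div_nonneg (hf.pos j).le hS0.le)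
    · exact hp
    · exact le_rfl
  have hdisj : Disjoint (Finset.Iic j₀) t := by
    rw [Finset.disjoint_left]
    intro j hj hjt
    exact absurd (Finset.mem_Iic.1 hj) (not_le.2 (ht j hjt).1)
  have hsum : ∑ j ∈ Finset.Iic j₀ ∪ t, w j = 1 := by
    rw [Finset.sum_union hdisj]
    have e1 : ∑ j ∈ Finset.Iic j₀, w j = 1 - t.card * p := by
      have : ∀ j ∈ Finset.Iic j₀, w j = (1 - t.card * p) * (f j / S) := fun j hj => by
        simp only [hw]; rw [if_pos (Finset.mem_Iic.1 hj)]
      rw [Finset.sum_congr rfl this, ← Finset.mul_sum, ← Finset.sum_div, ← hS, div_self hS0.ne',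
        mul_one]
    have e2 : ∑ j ∈ t, w j = t.card * p := by
      have : ∀ j ∈ t, w j = p := fun j hj => by
        simp only [hw]; rw [if_neg (not_le.2 (ht j hj).1), if_pos hj]
      rw [Finset.sum_congr rfl this, Finset.sum_const, nsmul_eq_mul]
    rw [e1, e2]; ring
  refine ⟨PMF.ofFinset (fun j => ENNReal.ofReal (w j)) (Finset.Iic j₀ ∪ t) ?_ ?_, ?_, ?_, ?_⟩
  · rw [← ENNReal.ofReal_sum_of_nonneg fun j _ => hw0 j, hsum, ENNReal.ofReal_one]
  · intro j hj
    rw [Finset.mem_union, not_or, Finset.mem_Iic] at hj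
    simp only [hw]
    rw [if_neg hj.1, if_neg hj.2, ENNReal.ofReal_zero]
  · intro j
    rw [PMF.ofFinset_apply]
    refine ENNReal.ofReal_le_ofReal ?_
    simp only [hw]
    split_ifs with h1 h2
    · have h3 : f j / S ≤ f j := div_le_self (hf.pos j).le hj₀
      have h4 : 0 ≤ t.card * p := mul_nonneg (Nat.cast_nonneg _) hp
      exact (mul_le_of_le_one_left (div_nonneg (hf.pos j).le hS0.le) (by linarith)).trans h3
    · exact (ht j h2).2
    · exact (hf.pos j).le
  · intro j hj
    rw [PMF.ofFinset_apply]
    simp only [hw]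
    rw [if_neg (not_le.2 (ht j hj).1), if_pos hj]
  · intro j hj hjt
    rw [PMF.ofFinset_apply]
    simp only [hw]
    rw [if_neg (not_le.2 hj), if_neg hjt, ENNReal.ofReal_zero]

/-- The envelope leaves room for a probability on finitely many symbols, as `1 < ∑ f`. -/
theorem exists_one_le_sum_Iic {f : ℕ+ → ℝ} (hf : IsEnvelope f) :
    ∃ j₀ : ℕ+, 1 ≤ ∑ j ∈ Finset.Iic j₀, f j := by
  obtain ⟨s, hs⟩ := ((hf.summable.hasSum.eventually (lt_mem_nhds hf.one_lt_tsum))).exists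
  obtain ⟨j₀, hj⟩ := s.bddAbove
  refine ⟨j₀, hs.le.trans ?_⟩
  exact Finset.sum_le_sum_of_subset_of_nonneg
    (fun j h => Finset.mem_Iic.2 (hj h)) fun j _ _ => (hf.pos j).le

/-- The redundancy forced by `m` consecutive pairs of symbols beyond `b`: the pair number `j` consists
of `b + 2 * j + 1` and `b + 2 * j + 2`. -/
theorem le_minimaxRedundancy {f : ℕ+ → ℝ} (hf : IsEnvelope f) {j₀ : ℕ+}
    (hj₀ : 1 ≤ ∑ j ∈ Finset.Iic j₀, f j) {p : ℝ} (hp : 0 ≤ p) (m b : ℕ) (hb : (j₀ : ℕ) ≤ b)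
    (hpf : ∀ j : ℕ+, b < (j : ℕ) → (j : ℕ) ≤ b + 2 * m → p ≤ f j) (hpm : m * p ≤ 1)
    (hp1 : p ≤ 1) (n : ℕ) :
    ENNReal.ofReal (m * (1 - (1 - p) ^ n)) ≤ minimaxRedundancy n (envelopeClass f) := by
  refine le_iInf fun Q => ?_
  let s : Fin m → Bool → ℕ+ := fun j c => (b + 2 * j + c.toNat).succPNat
  have hsv : ∀ j c, (s j c : ℕ) = b + 2 * j + c.toNat + 1 := fun j c => rfl
  have hsinj : ∀ j j' c c', s j c = s j' c' → j = j' ∧ c = c' := by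
    intro j j' c c' h
    have h := congrArg (fun a : ℕ+ => (a : ℕ)) h
    simp only [hsv] at h
    constructor
    · ext
      have := Bool.toNat_le c
      have := Bool.toNat_le c'
      omega
    · cases c <;> cases c' <;> simp at h ⊢ <;> omega
  have hsrc : ∀ θ : Fin m → Bool, ∃ P ∈ envelopeClass f,
      (∀ j, P (s j (θ j)) = ENNReal.ofReal p) ∧ ∀ j, P (s j (!θ j)) = 0 := by
    intro θ
    obtain ⟨P, hP, h1, h2⟩ := exists_source hf hj₀ hp
      (Finset.univ.image fun j : Fin m => s j (θ j)) (by
        intro a ha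
        obtain ⟨j, -, rfl⟩ := Finset.mem_image.1 ha
        have hj := j.2
        have := Bool.toNat_le (θ j)
        constructor
        · rw [← PNat.coe_lt_coe, hsv]; omega
        · refine hpf _ ?_ ?_ <;> rw [hsv] <;> omega) (by
        refine le_trans (mul_le_mul_of_nonneg_right ?_ hp) hpm
        have := Finset.card_image_le (s := Finset.univ) (f := fun j : Fin m => s j (θ j))
        rw [Finset.card_univ, Fintype.card_fin] at this
        exact_mod_cast this)
    refine ⟨P, hP, fun j => h1 _ (Finset.mem_image_of_mem _ (Finset.mem_univ j)), fun j => ?_⟩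
    refine h2 _ ?_ ?_
    · rw [← PNat.coe_lt_coe, hsv]; omega
    · intro h
      obtain ⟨j', -, h⟩ := Finset.mem_image.1 h
      obtain ⟨rfl, h⟩ := hsinj _ _ _ _ h
      simp at h
  choose P hP h1 h2 using hsrc
  exact le_maximalRedundancy_of_pairs hp hp1 s P hP h1 h2 Q

/-- The minimax redundancy is at least of the order of the effective alphabet size. -/
theorem exists_mul_effectiveSize_le_minimaxRedundancy {f : ℕ+ → ℝ} (hf : IsEnvelope f)
    (hmono : UltimatelyNonincreasing f) {α : ℝ} (hα : 0 < α)
    (hRV : ∀ y, 0 < y →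
      Tendsto (fun t => realTail f (t * y) / realTail f t) atTop (𝓝 (y ^ (-α)))) :
    ∃ κ, 0 < κ ∧ ∀ n : ℕ, 1 ≤ n →
      ENNReal.ofReal (κ * effectiveSize (realTail f) n)
        ≤ minimaxRedundancy n (envelopeClass f) := by
  have hG := realTail_antitone hf
  have hGpos := realTail_pos hf
  set T := effectiveSize (realTail f) with hT
  obtain ⟨j₀, hj₀⟩ := exists_one_le_sum_Iic hf
  obtain ⟨N₁, hN₁⟩ := hmono
  set b : ℕ := max (j₀ : ℕ) N₁ with hb
  -- the mass of `(τ/2, Kτ]` is of the order of `τ / n`, where `τ` is the effective size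
  obtain ⟨K, hK, hK1⟩ : ∃ K : ℝ, (K / 2) ^ (-α) < 1 / 8 ∧ 1 ≤ K := by
    have h1 := (tendsto_rpow_neg_atTop hα).comp
      (tendsto_id.atTop_div_const (show (0 : ℝ) < 2 by norm_num))
    obtain ⟨K, h⟩ := ((h1.eventually (gt_mem_nhds (show (0 : ℝ) < 1 / 8 by norm_num))).and
      (eventually_ge_atTop 1)).exists
    exact ⟨K, h⟩
  set c : ℝ := min (1 / (4 * K)) (min 1 (1 / realTail f 0)) with hc
  have hc0 : 0 < c := by
    have := hGpos 0
    positivity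
  have hcK : c ≤ 1 / (4 * K) := min_le_left _ _
  have hc1 : c ≤ 1 := (min_le_right _ _).trans (min_le_left _ _)
  have hcG : c * realTail f 0 ≤ 1 :=
    (le_div_iff₀ (hGpos 0)).1 ((min_le_right _ _).trans (min_le_right _ _))
  have hTtop : Tendsto (fun n : ℕ => T n) atTop atTop :=
    (tendsto_effectiveSize hG hGpos).comp tendsto_natCast_atTop_atTop
  have hRVK := (hRV (K / 2) (by linarith)).eventually (gt_mem_nhds hK)
  have hev : ∀ᶠ n : ℕ in atTop, ENNReal.ofReal ((1 - Real.exp (-c)) / 16 * T n)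
      ≤ minimaxRedundancy n (envelopeClass f) := by
    filter_upwards [(hTtop.const_mul_atTop (show (0 : ℝ) < 2 by norm_num)).eventually hRVK,
      tendsto_atTop.1 hTtop (max 16 (4 * b)), eventually_ge_atTop 1] with n h1 h2 hn1
    set τ := T n with hτ
    have hn0 : (0 : ℝ) < n := by exact_mod_cast hn1
    have hτ16 : 16 ≤ τ := (le_max_left _ _).trans h2
    have hτb : 4 * (b : ℝ) ≤ τ := (le_max_right _ _).trans h2
    have h3 : τ / 2 ≤ n * realTail f (τ / 2) :=
      le_mul_of_lt_effectiveSize hG hn0.le (by linarith) (by rw [← hT, ← hτ]; linarith)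
    have h4 : n * realTail f (2 * τ) < 2 * τ :=
      mul_lt_of_effectiveSize_lt hG hGpos (by rw [← hT, ← hτ]; linarith)
    rw [div_lt_iff₀ (hGpos _), show 2 * τ * (K / 2) = K * τ by ring] at h1
    have h5 : n * realTail f (K * τ) ≤ τ / 4 := by
      have := mul_lt_mul_of_pos_left h1 hn0
      linarith
    -- by monotonicity, a symbol up to `τ/2` has at least the average envelope value over `(τ/2, Kτ]`
    have hfj : ∀ j : ℕ+, b < (j : ℕ) → (j : ℕ) ≤ ⌊τ / 2⌋₊ → c / n ≤ f j := by
      intro j hbj hj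
      have hkl : ⌊τ / 2⌋₊ ≤ ⌊K * τ⌋₊ := Nat.floor_mono (by nlinarith)
      set A : Finset ℕ+ := (Finset.Iic ⌊K * τ⌋₊.succPNat).filter
        fun i => ⌊τ / 2⌋₊ < (i : ℕ) ∧ (i : ℕ) ≤ ⌊K * τ⌋₊ with hA
      have hmemA : ∀ i : ℕ+, i ∈ A ↔ ⌊τ / 2⌋₊ < (i : ℕ) ∧ (i : ℕ) ≤ ⌊K * τ⌋₊ := by
        intro i
        rw [hA, Finset.mem_filter, Finset.mem_Iic, and_iff_right_iff_imp]
        rintro ⟨-, h⟩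
        rw [← PNat.coe_le_coe, Nat.succPNat_coe]
        omega
      have e := envelopeTail_eq_sum_add hf ⌊τ / 2⌋₊ A ⌊K * τ⌋₊ hmemA hkl
      have h6 : ∀ i ∈ A, f i ≤ f j := by
        intro i hi
        have hi1 := ((hmemA i).1 hi).1
        have hNj : N₁ ≤ j := by
          rw [← PNat.coe_le_coe]
          exact (le_max_right _ _).trans hbj.le
        have hji : j ≤ i := by
          rw [← PNat.coe_le_coe]; omega
        exact hN₁ hNj (hNj.trans hji) hji
      have h7 := Finset.sum_le_card_nsmul _ _ _ h6
      rw [nsmul_eq_mul] at h7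
      have h8 : (A.card : ℝ) ≤ K * τ := by
        refine le_trans ?_ (Nat.floor_le (by nlinarith))
        have := Finset.card_le_card_of_injOn (s := A) (t := Finset.Ioc ⌊τ / 2⌋₊ ⌊K * τ⌋₊)
          (fun i : ℕ+ => (i : ℕ)) (fun i hi => by
            have := (hmemA i).1 hi
            simpa using this) (fun i _ j _ h => PNat.eq h)
        rw [Nat.card_Ioc] at this
        exact_mod_cast this.trans (Nat.sub_le _ _)
      have h9 := h7.trans (mul_le_mul_of_nonneg_right h8 (hf.pos j).le)
      have h10 : realTail f (τ / 2) ≤ K * τ * f j + realTail f (K * τ) := by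
        have : realTail f (τ / 2) = envelopeTail f ⌊τ / 2⌋₊ := rfl
        rw [this, e]
        exact add_le_add_left h9 _
      have h11 := mul_le_mul_of_nonneg_left h10 hn0.le
      have h12 : τ * 1 ≤ τ * (4 * K * n * f j) := by
        rw [mul_add] at h11
        nlinarith
      have h13 := le_of_mul_le_mul_left h12 (by linarith)
      refine (div_le_div_of_nonneg_right hcK hn0.le).trans ?_
      rw [div_div, div_le_iff₀ (by positivity)]
      linarith
    set m := ⌊τ / 8⌋₊ with hm
    have hm1 : (m : ℝ) ≤ τ / 8 := Nat.floor_le (by linarith)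
    have hm2 : τ / 8 < m + 1 := Nat.lt_floor_add_one _
    have hbm : b + 2 * m ≤ ⌊τ / 2⌋₊ := Nat.le_floor (by push_cast; linarith)
    have hcn : c / n ≤ 1 := by
      rw [div_le_one hn0]
      have : (1 : ℝ) ≤ n := by exact_mod_cast hn1
      linarith
    have hmp : m * (c / n) ≤ 1 := by
      have h14 : τ ≤ n * realTail f 0 := effectiveSize_le_mul hG hGpos hn0.le
      rw [← mul_div_assoc, div_le_one hn0]
      have h15 := mul_le_mul_of_nonneg_right hm1 hc0.le
      have h16 := mul_le_mul_of_nonneg_right h14 hc0.le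
      have h17 := mul_le_mul_of_nonneg_left hcG hn0.le
      nlinarith
    refine le_trans (ENNReal.ofReal_le_ofReal ?_) (le_minimaxRedundancy hf hj₀
      (div_nonneg hc0.le hn0.le) m b (le_max_left _ _)
      (fun j hj1 hj2 => hfj j hj1 (hj2.trans hbm)) hmp hcn n)
    have h18 : (1 - c / n) ^ n ≤ Real.exp (-c) := by
      have := Real.one_sub_div_pow_le_exp_neg (n := n) (t := c)
        (by have : (1 : ℝ) ≤ n := by exact_mod_cast hn1
            linarith)
      exact this
    have h19 : Real.exp (-c) ≤ 1 := by rw [Real.exp_le_one_iff]; linarith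
    have h20 : (1 - Real.exp (-c)) * (τ / 16) ≤ (1 - (1 - c / n) ^ n) * m := by
      refine mul_le_mul (by linarith) (by linarith) (by linarith) (by linarith)
    linarith
  obtain ⟨N, hN⟩ := eventually_atTop.1 hev
  -- for small `n` a single pair gives a positive lower bound
  set p : ℝ := min (min (f (b + 1).toPNat') (f (b + 2).toPNat')) 1 with hp
  have hp0 : 0 < p := lt_min (lt_min (hf.pos _) (hf.pos _)) one_pos
  have hsmall : ∀ n : ℕ, 1 ≤ n → ENNReal.ofReal p ≤ minimaxRedundancy n (envelopeClass f) := by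
    intro n hn
    refine le_trans (ENNReal.ofReal_le_ofReal ?_) (le_minimaxRedundancy hf hj₀ hp0.le 1 b
      (le_max_left _ _) ?_ (by simp [hp]) (min_le_right _ _) n)
    · have := pow_le_pow_of_le_one (show 0 ≤ 1 - p by
        have := min_le_right (min (f (b + 1).toPNat') (f (b + 2).toPNat')) 1
        linarith) (by linarith) hn
      rw [pow_one] at this
      push_cast
      linarith
    · intro j h1 h2
      have h3 : j = (b + 1).toPNat' ∨ j = (b + 2).toPNat' := by
        rcases (by omega : (j : ℕ) = b + 1 ∨ (j : ℕ) = b + 2) with h | h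
        · left; rw [← PNat.coe_inj, h]; rfl
        · right; rw [← PNat.coe_inj, h]; rfl
      refine (min_le_left _ _).trans ?_
      rcases h3 with rfl | rfl
      · exact min_le_left _ _
      · exact min_le_right _ _
  have hTN : 0 < T (N + 1) := effectiveSize_pos hG hGpos (by positivity)
  have hexp : 0 < 1 - Real.exp (-c) := by
    have : Real.exp (-c) < 1 := by rw [Real.exp_lt_one_iff]; linarith
    linarith
  refine ⟨min ((1 - Real.exp (-c)) / 16) (p / T (N + 1)), by positivity, fun n hn => ?_⟩
  have hTn : 0 ≤ T n := effectiveSize_nonneg _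
  by_cases hnN : N ≤ n
  · refine (ENNReal.ofReal_le_ofReal ?_).trans (hN n hnN)
    exact mul_le_mul_of_nonneg_right (min_le_left _ _) hTn
  · refine (ENNReal.ofReal_le_ofReal ?_).trans (hsmall n hn)
    refine (mul_le_mul_of_nonneg_right (min_le_right _ _) hTn).trans ?_
    rw [div_mul_eq_mul_div, div_le_iff₀ hTN]
    refine mul_le_mul_of_nonneg_left (effectiveSize_mono hG hGpos ?_) hp0.le
    have : (n : ℝ) ≤ N := by exact_mod_cast (by omega : n ≤ N)
    linarith

/-! ### The threshold -/

theorem getD_le_iff_countP_lt {l : List ℕ} (hl : l.Pairwise (· ≥ ·)) (a : ℕ) {k : ℕ}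
    (h1 : 1 ≤ k) (hk : k ≤ l.length) :
    l.getD (k - 1) 0 ≤ a ↔ l.countP (fun y => decide (a < y)) < k := by
  induction l generalizing k with
  | nil => simp at hk; omega
  | cons x t ih =>
    rw [List.pairwise_cons] at hl
    have hzero : x ≤ a → t.countP (fun y => decide (a < y)) = 0 := by
      intro hx
      rw [List.countP_eq_zero]
      intro y hy
      have := hl.1 y hy
      simp only [decide_eq_true_eq]
      omega
    rw [List.countP_cons]
    simp only [decide_eq_true_eq]
    obtain ⟨k, rfl⟩ : ∃ k', k = k' + 1 := ⟨k - 1, by omega⟩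
    rcases Nat.eq_zero_or_pos k with rfl | hk0
    · simp only [zero_add, Nat.sub_self, List.getD_cons_zero]
      split_ifs with h
      · omega
      · have := hzero (by omega)
        omega
    · have := ih hl.2 (k := k) hk0 (by simpa using hk)
      rw [show k + 1 - 1 = (k - 1) + 1 by omega, List.getD_cons_succ, this]
      split_ifs with h
      · omega
      · have := hzero (by omega)
        omega

theorem orderStat_le_iff (h : List ℕ) {k : ℕ} (h1 : 1 ≤ k) (hk : k ≤ h.length) :
    orderStat h k ≤ k ↔ h.countP (fun y => decide (k < y)) < k := by
  have hp := List.perm_insertionSort (· ≥ ·) h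
  rw [orderStat, getD_le_iff_countP_lt (List.pairwise_insertionSort (· ≥ ·) h) k h1
    (by rwa [hp.length_eq]), hp.countP_eq]

theorem threshold_le_of_countP_lt (h : List ℕ) {k : ℕ}
    (hc : h.countP (fun y => decide (k < y)) < k) : threshold h ≤ k := by
  by_cases hk : k ≤ h.length
  · exact Nat.sInf_le (Set.mem_insert_of_mem _
      ⟨by omega, hk, (orderStat_le_iff h (by omega) hk).2 hc⟩)
  · exact (threshold_le_length h).trans (by omega)

theorem threshold_spec (h : List ℕ) : threshold h = h.length ∨
    h.countP (fun y => decide (threshold h < y)) < threshold h := by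
  have : threshold h ∈ insert h.length {k : ℕ | 1 ≤ k ∧ k ≤ h.length ∧ orderStat h k ≤ k} :=
    Nat.sInf_mem ⟨_, Set.mem_insert _ _⟩
  rcases this with h1 | ⟨h1, h2, h3⟩
  · exact Or.inl h1
  · exact Or.inr ((orderStat_le_iff h h1 h2).1 h3)

theorem countP_threshold_le (h : List ℕ) :
    h.countP (fun y => decide (threshold h < y)) ≤ threshold h := by
  rcases threshold_spec h with h1 | h1
  · have := List.countP_le_length (p := fun y => decide (threshold h < y)) (l := h)
    omega
  · exact h1.le

theorem countP_lt_anti (h : List ℕ) {k l : ℕ} (hkl : k ≤ l) :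
    h.countP (fun y => decide (l < y)) ≤ h.countP (fun y => decide (k < y)) :=
  List.countP_mono_left fun y _ hy => by
    simp only [decide_eq_true_eq] at *
    omega

theorem threshold_le_add_countP (h : List ℕ) {k : ℕ} (hk : 1 ≤ k) :
    threshold h ≤ k + h.countP (fun y => decide (k < y)) := by
  refine threshold_le_of_countP_lt h ?_
  have := countP_lt_anti h (Nat.le_add_right k (h.countP (fun y => decide (k < y))))
  omega

/-- Leave-one-out bound: among the entries `v k` of `h`, at most `threshold h` exceed the threshold
of the list `r k` of the other entries. Removing an entry lowers the threshold by at most one, and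
it does so for an entry equal to the threshold only if few entries are that large. -/
theorem card_leave_one_out_le {ι : Type*} (s : Finset ι) (v : ι → ℕ) (r : ι → List ℕ)
    (h : List ℕ) (hlen : ∀ k ∈ s, h.length = (r k).length + 1)
    (hcount : ∀ k ∈ s, ∀ a, h.countP (fun y => decide (a < y))
      = (r k).countP (fun y => decide (a < y)) + if a < v k then 1 else 0)
    (hcard : ∀ a, (s.filter fun k => a < v k).card ≤ h.countP (fun y => decide (a < y))) :
    (s.filter fun k => threshold (r k) < v k).card ≤ threshold h := by
  have step : ∀ k ∈ s, threshold h ≤ threshold (r k) + 1 := by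
    intro k hk
    rcases threshold_spec (r k) with h1 | h1
    · have := hlen k hk
      have := threshold_le_length h
      omega
    · refine threshold_le_of_countP_lt h ?_
      have h2 := countP_lt_anti h (Nat.le_add_right (threshold (r k)) 1)
      have h3 := hcount k hk (threshold (r k))
      split_ifs at h3 <;> omega
  -- otherwise some entry `k₀` with `v k₀ = threshold h` lowers the threshold when removed
  by_cases hall : ∀ k ∈ s, threshold (r k) < v k → threshold h < v k
  · refine le_trans (Finset.card_le_card ?_) ((hcard (threshold h)).trans (countP_threshold_le h))
    intro k hk
    rw [Finset.mem_filter] at hk ⊢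
    exact ⟨hk.1, hall k hk.1 hk.2⟩
  · push Not at hall
    obtain ⟨k₀, hk₀, h1, h2⟩ := hall
    have h3 := step k₀ hk₀
    have h4 : threshold h = threshold (r k₀) + 1 := by omega
    refine le_trans (Finset.card_le_card (t := s.filter fun k => threshold (r k₀) < v k) ?_) ?_
    · intro k hk
      rw [Finset.mem_filter] at hk ⊢
      have := step k hk.1
      exact ⟨hk.1, by omega⟩
    · refine (hcard _).trans ?_
      rw [hcount k₀ hk₀, if_pos h1, h4]
      have := countP_threshold_le (r k₀)
      omega

/-! ### The code length of a message -/

/-- The subsequence of the non-redacted symbols of the second list, read after the first one. -/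
noncomputable def kept : List ℕ → List ℕ → List ℕ
  | _, [] => []
  | h, a :: rest => if a ≤ threshold h then a :: kept (h ++ [a]) rest else kept (h ++ [a]) rest

/-- The sum of `c history symbol` over the symbols of the second list, read after the first one. -/
def pathSum (c : List ℕ → ℕ → ℝ) : List ℕ → List ℕ → ℝ
  | _, [] => 0
  | h, a :: rest => c h a + pathSum c (h ++ [a]) rest

/-- `1` if the symbol is redacted after the given history. -/
noncomputable def redacted (h : List ℕ) (a : ℕ) : ℝ := if a ≤ threshold h then 0 else 1

theorem kept_subset (h l : List ℕ) : kept h l ⊆ l := by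
  induction l generalizing h with
  | nil => simp [kept]
  | cons a t ih =>
    rw [kept]
    split_ifs
    · exact List.cons_subset_cons _ (ih _)
    · exact List.subset_cons_of_subset _ (ih _)

theorem length_kept_add (h l : List ℕ) :
    ((kept h l).length : ℝ) + pathSum redacted h l = l.length := by
  induction l generalizing h with
  | nil => simp [kept, pathSum]
  | cons a t ih =>
    have := ih (h ++ [a])
    rw [kept, pathSum, redacted, List.length_cons]
    split_ifs
    · rw [List.length_cons]; push_cast; linarith
    · push_cast; linarith

theorem arithmeticLength_mul_log_le {q : ℝ} (hq : 0 < q) (hq1 : q ≤ 1) :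
    arithmeticLength q * Real.log 2 ≤ -Real.log q + 2 * Real.log 2 := by
  have hl2 : 0 < Real.log 2 := Real.log_pos (by norm_num)
  have h0 : 0 ≤ Real.logb 2 (1 / q) :=
    Real.logb_nonneg (by norm_num) (by rw [le_div_iff₀ hq]; linarith)
  have h1 := (Nat.ceil_lt_add_one h0).le
  have h2 : Real.logb 2 (1 / q) * Real.log 2 = -Real.log q := by
    rw [Real.logb, div_mul_cancel₀ _ hl2.ne', one_div, Real.log_inv]
  rw [arithmeticLength]
  push_cast
  nlinarith

theorem predictive_le_one {h : List ℕ} {j : ℕ} : predictive h j ≤ 1 := by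
  have hc : (h.count j : ℝ) ≤ h.length := by exact_mod_cast List.count_le_length
  have hT : (0 : ℝ) ≤ threshold h := Nat.cast_nonneg _
  have hh : (0 : ℝ) ≤ h.length := Nat.cast_nonneg _
  rw [predictive, div_le_one (by positivity)]
  split_ifs <;> linarith

theorem neg_log_predictive_zero_le {h : List ℕ} {N : ℕ} (hN : h.length ≤ N) :
    -Real.log (predictive h 0) ≤ Real.log (3 * N + 1) := by
  have hT : (threshold h : ℝ) ≤ h.length := by exact_mod_cast threshold_le_length h
  have hN' : (h.length : ℝ) ≤ N := by exact_mod_cast hN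
  rw [← Real.log_inv]
  refine Real.log_le_log (inv_pos.2 (predictive_pos h 0)) ?_
  rw [predictive, if_pos rfl, inv_div, div_le_iff₀ (by norm_num)]
  linarith

/-- `log c! - log (c + 1)`, the contribution of a symbol seen `c` times to the logarithm of the
number of its arrangements; the correction `log (c + 1)` absorbs the `1/2` of the estimator. -/
noncomputable def logWeight (c : ℕ) : ℝ := Real.log (c.factorial : ℝ) - Real.log ((c + 1 : ℕ) : ℝ)

theorem log_factorial_succ (n : ℕ) :
    Real.log ((n + 1).factorial : ℝ) = Real.log ((n + 1 : ℕ) : ℝ) + Real.log (n.factorial : ℝ) := by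
  rw [Nat.factorial_succ, Nat.cast_mul, Real.log_mul (by positivity) (by positivity)]

theorem sum_count_append {S : Finset ℕ} (φ : ℕ → ℝ) (h : List ℕ) {a : ℕ} (ha : a ∈ S) :
    ∑ j ∈ S, φ ((h ++ [a]).count j)
      = ∑ j ∈ S, φ (h.count j) + (φ (h.count a + 1) - φ (h.count a)) := by
  rw [← Finset.add_sum_erase _ _ ha, ← Finset.add_sum_erase S (fun j => φ (h.count j)) ha]
  have : ∑ j ∈ S.erase a, φ ((h ++ [a]).count j) = ∑ j ∈ S.erase a, φ (h.count j) := by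
    refine Finset.sum_congr rfl fun j hj => ?_
    rw [List.count_append, List.count_singleton, if_neg, add_zero]
    have := Finset.ne_of_mem_erase hj
    simpa using this.symm
  rw [this, List.count_append, List.count_singleton_self]
  ring

/-- The cost of a non-redacted symbol seen `m` times in the history and `c ≤ m` times among its
non-redacted symbols. -/
theorem neg_log_predictive_le {h : List ℕ} {a c : ℕ} (ha : 1 ≤ a) (hc : c ≤ h.count a) :
    -Real.log (predictive h a) + (logWeight (c + 1) - logWeight c)
      ≤ Real.log ((h.length + 1 : ℕ) : ℝ) + (threshold h : ℝ) / ((h.length + 1 : ℕ) : ℝ) := by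
  have hc' : (c : ℝ) ≤ h.count a := by exact_mod_cast hc
  have hc0 : (0 : ℝ) ≤ c := Nat.cast_nonneg _
  have hT : (0 : ℝ) ≤ threshold h := Nat.cast_nonneg _
  have hh : (0 : ℝ) ≤ h.length := Nat.cast_nonneg _
  have hden : (0 : ℝ) < (h.length : ℝ) + ((threshold h : ℝ) + 1) / 2 := by positivity
  have hl1 : (0 : ℝ) < ((h.length + 1 : ℕ) : ℝ) := by positivity
  rw [predictive, if_neg (by omega), Real.log_div (by linarith) hden.ne', logWeight, logWeight,
    log_factorial_succ]
  have h1 : Real.log ((h.length : ℝ) + ((threshold h : ℝ) + 1) / 2)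
      ≤ Real.log ((h.length + 1 : ℕ) : ℝ) + (threshold h : ℝ) / ((h.length + 1 : ℕ) : ℝ) := by
    have h2 : (0 : ℝ) < 1 + (threshold h : ℝ) / ((h.length + 1 : ℕ) : ℝ) := by positivity
    have h3 := Real.log_le_sub_one_of_pos h2
    have h4 : Real.log ((h.length : ℝ) + ((threshold h : ℝ) + 1) / 2) ≤
        Real.log (((h.length + 1 : ℕ) : ℝ) * (1 + (threshold h : ℝ) / ((h.length + 1 : ℕ) : ℝ))) := by
      refine Real.log_le_log hden ?_
      rw [mul_add, mul_one, mul_div_cancel₀ _ hl1.ne']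
      push_cast
      linarith
    rw [Real.log_mul hl1.ne' h2.ne'] at h4
    linarith
  have h5 : Real.log ((c + 1 : ℕ) : ℝ) + Real.log ((c + 1 : ℕ) : ℝ)
      ≤ Real.log ((c + 1 + 1 : ℕ) : ℝ) + Real.log ((h.count a : ℝ) + 1 / 2) := by
    rw [← Real.log_mul (by positivity) (by positivity),
      ← Real.log_mul (by positivity) (by positivity)]
    refine Real.log_le_log (by positivity) ?_
    push_cast
    nlinarith
  linarith

/-- Potential bound for the encoder. The potential is `log i! - ∑ logWeight` with the counts taken
among the non-redacted symbols `h'` of the history; a redacted symbol is charged separately, its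
Elias codeword being paid for by its small probability. -/
theorem encoderBits_mul_log_le {p : ℕ → ℝ} {C : ℝ} {S : Finset ℕ} {N : ℕ}
    (hC : ∀ a M, M < a → 0 < p a → Real.log (p a) + eliasLength (a - M + 1) * Real.log 2 ≤ C) :
    ∀ (rest h h' : List ℕ) (q : ℝ), 0 < q → q ≤ 1 →
      (∀ a ∈ rest, a ∈ S ∧ 1 ≤ a ∧ 0 < p a) → h.length + rest.length ≤ N →
      (∀ j, h'.count j ≤ h.count j) →
      encoderBits h q rest * Real.log 2 + (rest.map fun a => Real.log (p a)).sum
          + (Real.log (h.length.factorial : ℝ) - ∑ j ∈ S, logWeight (h'.count j))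
        ≤ -Real.log q + (Real.log ((h.length + rest.length).factorial : ℝ)
            - ∑ j ∈ S, logWeight ((h' ++ kept h rest).count j))
          + ((kept h rest).map fun a => Real.log (p a)).sum
          + (C + Real.log (3 * N + 1) + 2 * Real.log 2) * pathSum redacted h rest
          + pathSum (fun h _ => (threshold h : ℝ) / ((h.length + 1 : ℕ) : ℝ)) h rest
          + (Real.log (3 * N + 1) + 2 * Real.log 2 + eliasLength 1 * Real.log 2) := by
  intro rest
  induction rest with
  | nil =>
    intro h h' q hq hq1 _ hN _
    have h1 := arithmeticLength_mul_log_le (mul_pos hq (predictive_pos h 0))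
      (mul_le_one₀ hq1 (predictive_pos h 0).le predictive_le_one)
    rw [Real.log_mul hq.ne' (predictive_pos h 0).ne'] at h1
    have h2 := neg_log_predictive_zero_le (h := h) (N := N) (by simpa using hN)
    simp only [encoderBits, kept, pathSum, List.map_nil, List.sum_nil, List.append_nil,
      List.length_nil, add_zero, mul_zero]
    push_cast
    linarith
  | cons a t ih =>
    intro h h' q hq hq1 hrest hN hcount
    obtain ⟨haS, ha1, hpa⟩ := hrest a List.mem_cons_self
    have hrest' : ∀ b ∈ t, b ∈ S ∧ 1 ≤ b ∧ 0 < p b := fun b hb =>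
      hrest b (List.mem_cons_of_mem _ hb)
    have hN' : (h ++ [a]).length + t.length ≤ N := by simp at hN ⊢; omega
    have hlen : h.length + (a :: t).length = (h ++ [a]).length + t.length := by simp; omega
    have hlen1 : (h ++ [a]).length = h.length + 1 := by simp
    have hfact := log_factorial_succ h.length
    -- a non-redacted symbol joins `h'`; a redacted one does not, and flushes the arithmetic encoder
    by_cases haT : a ≤ threshold h
    · have hind := ih (h ++ [a]) (h' ++ [a]) (q * predictive h a)
        (mul_pos hq (predictive_pos h a))
        (mul_le_one₀ hq1 (predictive_pos h a).le predictive_le_one) hrest' hN' (fun j => by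
          rw [List.count_append, List.count_append]
          exact Nat.add_le_add_right (hcount j) _)
      rw [Real.log_mul hq.ne' (predictive_pos h a).ne', sum_count_append logWeight h' haS,
        hlen1, hfact] at hind
      have hstep := neg_log_predictive_le (h := h) (c := h'.count a) ha1 (hcount a)
      simp only [encoderBits, kept, pathSum, redacted, if_pos haT, hlen, hlen1, List.map_cons,
        List.sum_cons, zero_add] at hind ⊢
      rw [List.append_assoc, List.singleton_append] at hind
      linarith
    · have hind := ih (h ++ [a]) h' 1 one_pos le_rfl hrest' hN' (fun j => by
          rw [List.count_append]
          exact (hcount j).trans (Nat.le_add_right _ _))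
      rw [Real.log_one, hlen1, hfact] at hind
      have h1 := arithmeticLength_mul_log_le (mul_pos hq (predictive_pos h 0))
        (mul_le_one₀ hq1 (predictive_pos h 0).le predictive_le_one)
      rw [Real.log_mul hq.ne' (predictive_pos h 0).ne'] at h1
      have h2 := neg_log_predictive_zero_le (h := h) (N := N) (by omega)
      have h3 := hC a (threshold h) (not_le.1 haT) hpa
      have h4 : 0 ≤ Real.log ((h.length + 1 : ℕ) : ℝ) := Real.log_natCast_nonneg _
      have h5 : (0 : ℝ) ≤ (threshold h : ℝ) / ((h.length + 1 : ℕ) : ℝ) := by positivity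
      simp only [encoderBits, kept, pathSum, redacted, if_neg haT, hlen, hlen1, List.map_cons,
        List.sum_cons] at hind ⊢
      push_cast at hind h4 h5 ⊢
      linarith

theorem sum_map_eq_sum_count {S : Finset ℕ} (φ : ℕ → ℝ) (l : List ℕ) (hS : ∀ a ∈ l, a ∈ S) :
    (l.map φ).sum = ∑ j ∈ S, (l.count j : ℝ) * φ j := by
  rw [Finset.sum_list_map_count]
  simp only [nsmul_eq_mul]
  refine Finset.sum_subset (fun a ha => hS a (List.mem_toFinset.1 ha)) fun j _ hj => ?_
  rw [List.count_eq_zero.2 fun h => hj (List.mem_toFinset.2 h)]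
  simp

/-- The words with the composition of `l` have total probability at most one. -/
theorem log_multinomial_add_le {p : ℕ → ℝ} (hp : ∀ j, 0 ≤ p j) {S : Finset ℕ}
    (hsum : ∑ j ∈ S, p j ≤ 1) {l : List ℕ} (hl : ∀ a ∈ l, a ∈ S ∧ 0 < p a) :
    Real.log (l.length.factorial : ℝ) - ∑ j ∈ S, Real.log ((l.count j).factorial : ℝ)
      + (l.map fun a => Real.log (p a)).sum ≤ 0 := by
  have hne : ∀ j ∈ S, p j ^ l.count j ≠ 0 := by
    intro j _
    by_cases hj : j ∈ l
    · exact pow_ne_zero _ (hl j hj).2.ne'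
    · rw [List.count_eq_zero.2 hj, pow_zero]; exact one_ne_zero
  have hcard : ∑ j ∈ S, l.count j = l.length := by
    have := Multiset.sum_count_eq_card (s := S) (m := (l : Multiset ℕ))
      (fun a ha => (hl a (by simpa using ha)).1)
    simpa using this
  have hterm : (Nat.multinomial S fun j => l.count j : ℝ) * ∏ j ∈ S, p j ^ l.count j ≤ 1 := by
    have h1 := Finset.sum_pow_eq_sum_piAntidiag S p l.length
    have h2 := Finset.single_le_sum
      (f := fun k : ℕ → ℕ => (Nat.multinomial S k : ℝ) * ∏ i ∈ S, p i ^ k i)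
      (s := S.piAntidiag l.length)
      (fun k _ => mul_nonneg (Nat.cast_nonneg _)
        (Finset.prod_nonneg fun i _ => pow_nonneg (hp i) _))
      (a := fun j => l.count j) (by
        rw [Finset.mem_piAntidiag]
        refine ⟨hcard, fun j hj => (hl j ?_).1⟩
        by_contra hcon
        exact hj (List.count_eq_zero.2 hcon))
    rw [← h1] at h2
    exact h2.trans (pow_le_one₀ (Finset.sum_nonneg fun j _ => hp j) hsum)
  have hprod : 0 < ∏ j ∈ S, p j ^ l.count j :=
    Finset.prod_pos fun j hj => lt_of_le_of_ne (pow_nonneg (hp j) _) (hne j hj).symm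
  have hspec := Nat.multinomial_spec S fun j => l.count j
  rw [hcard] at hspec
  have hmul : 0 < (Nat.multinomial S fun j => l.count j : ℝ) := by
    exact_mod_cast Nat.multinomial_pos _ _
  have hlog : Real.log (l.length.factorial : ℝ)
      = ∑ j ∈ S, Real.log ((l.count j).factorial : ℝ)
        + Real.log (Nat.multinomial S fun j => l.count j : ℝ) := by
    rw [← hspec, Nat.cast_mul, Nat.cast_prod,
      Real.log_mul (Finset.prod_ne_zero_iff.2 fun j _ => by positivity) hmul.ne',
      Real.log_prod (fun j _ => by positivity)]
  have h3 := Real.log_nonpos (mul_nonneg hmul.le hprod.le) hterm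
  rw [Real.log_mul hmul.ne' hprod.ne', Real.log_prod hne] at h3
  rw [sum_map_eq_sum_count _ l (fun a ha => (hl a ha).1), hlog]
  simp only [Real.log_pow] at h3
  linarith

theorem log_factorial_sub_le {n k : ℕ} (hk : k ≤ n) :
    Real.log (n.factorial : ℝ) - Real.log (k.factorial : ℝ) ≤ ((n : ℝ) - k) * Real.log (n : ℝ) := by
  have h1 := Nat.factorial_mul_descFactorial (Nat.sub_le n k)
  rw [Nat.sub_sub_self hk] at h1
  have h2 := Nat.descFactorial_le_pow n (n - k)
  have h3 : 0 < n.descFactorial (n - k) := Nat.pos_of_ne_zero fun h => by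
    rw [h, mul_zero] at h1
    exact n.factorial_ne_zero h1.symm
  rw [← h1, Nat.cast_mul, Real.log_mul (by positivity) (by positivity), ← Nat.cast_sub hk,
    ← Real.log_pow]
  have : Real.log (n.descFactorial (n - k) : ℝ) ≤ Real.log ((n : ℝ) ^ (n - k)) :=
    Real.log_le_log (by exact_mod_cast h3) (by exact_mod_cast h2)
  linarith

/-- The pointwise redundancy of the encoder, in terms of the number of redacted symbols, the
accumulated thresholds and the number of distinct symbols of the message. -/
theorem encoderBits_add_log_le {p : ℕ → ℝ} (hp : ∀ j, 0 ≤ p j)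
    (hsum : ∀ S : Finset ℕ, ∑ j ∈ S, p j ≤ 1) {C : ℝ}
    (hC : ∀ a M, M < a → 0 < p a → Real.log (p a) + eliasLength (a - M + 1) * Real.log 2 ≤ C)
    {l : List ℕ} (hl : ∀ a ∈ l, 1 ≤ a ∧ 0 < p a) :
    encoderBits [] 1 l * Real.log 2 + (l.map fun a => Real.log (p a)).sum
      ≤ (C + Real.log l.length + Real.log (3 * l.length + 1) + 2 * Real.log 2)
            * pathSum redacted [] l
        + pathSum (fun h _ => (threshold h : ℝ) / ((h.length + 1 : ℕ) : ℝ)) [] l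
        + l.toFinset.card * Real.log (l.length + 1)
        + (Real.log (3 * l.length + 1) + 2 * Real.log 2 + eliasLength 1 * Real.log 2) := by
  have h1 := encoderBits_mul_log_le (S := l.toFinset) (N := l.length) hC l [] [] 1 one_pos le_rfl
    (fun a ha => ⟨List.mem_toFinset.2 ha, hl a ha⟩) (by simp) (fun j => le_rfl)
  set k := kept [] l with hk
  have hkl : k ⊆ l := kept_subset [] l
  have h2 := log_multinomial_add_le hp (hsum l.toFinset) (l := k)
    (fun a ha => ⟨List.mem_toFinset.2 (hkl ha), (hl a (hkl ha)).2⟩)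
  have hlen := length_kept_add [] l
  rw [← hk] at hlen
  have hred : 0 ≤ pathSum redacted [] l := by
    have : ∀ (l h : List ℕ), 0 ≤ pathSum redacted h l := by
      intro l
      induction l with
      | nil => intro h; exact le_rfl
      | cons a t ih =>
        intro h
        have := ih (h ++ [a])
        rw [pathSum, redacted]
        split_ifs <;> linarith
    exact this l []
  have hkn : k.length ≤ l.length := by
    have : (k.length : ℝ) ≤ l.length := by linarith
    exact_mod_cast this
  have h3 := log_factorial_sub_le hkn
  rw [show (l.length : ℝ) - k.length = pathSum redacted [] l by linarith] at h3
  have h4 : ∑ j ∈ l.toFinset, Real.log ((k.count j + 1 : ℕ) : ℝ)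
      ≤ l.toFinset.card * Real.log (l.length + 1) := by
    rw [← nsmul_eq_mul]
    refine Finset.sum_le_card_nsmul _ _ _ fun j _ => Real.log_le_log (by positivity) ?_
    exact_mod_cast Nat.succ_le_succ (List.count_le_length.trans hkn)
  simp only [List.length_nil, List.nil_append, List.count_nil, zero_add, Real.log_one,
    logWeight, Finset.sum_sub_distrib, Nat.factorial_zero, Nat.cast_one, sub_self,
    Finset.sum_const_zero, neg_zero, add_zero] at h1
  linarith

/-! ### The Elias codeword of an improbable symbol -/

theorem two_pow_binaryLength_le {z : ℕ} (hz : 1 ≤ z) : 2 ^ binaryLength z ≤ 2 * z := by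
  rw [binaryLength, max_eq_left hz, pow_succ, mul_comm]
  exact Nat.mul_le_mul_left 2 (Nat.pow_log_le_self 2 (by omega))

theorem two_pow_eliasLength_le {y k : ℕ} (hy : 1 ≤ y) (hk : y < 2 ^ k) :
    2 ^ eliasLength y ≤ (2 * k) ^ 2 * 2 ^ k := by
  have h1 : binaryLength y ≤ k := by
    rw [binaryLength, max_eq_left hy]
    exact Nat.log_lt_of_lt_pow (by omega) hk
  have h2 : 1 ≤ binaryLength y := Nat.succ_le_succ (Nat.zero_le _)
  rw [eliasLength, pow_add, mul_comm 2 (binaryLength _), pow_mul]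
  refine Nat.mul_le_mul (Nat.pow_le_pow_left ?_ 2) (Nat.pow_le_pow_right (by norm_num) h1)
  exact (two_pow_binaryLength_le h2).trans (by omega)

/-- A monotone envelope whose tail decays polynomially decays faster than `1 / a`, by a power. -/
theorem exists_le_mul_pow_log {f : ℕ+ → ℝ} (hf : IsEnvelope f) (hmono : UltimatelyNonincreasing f)
    {l : ℝ} (hl : l < 1)
    (hRV : Tendsto (fun t => realTail f (t * 2) / realTail f t) atTop (𝓝 l)) :
    ∃ c C : ℝ, 0 < c ∧ c < 1 ∧ 0 < C ∧ ∀ a : ℕ+, f a ≤ C * (c / 2) ^ Nat.log 2 a := by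
  obtain ⟨c, hc, hc1⟩ := exists_between (max_lt hl one_pos)
  have hc0 : 0 < c := (le_max_right l 0).trans_lt hc
  obtain ⟨N₁, hN₁⟩ := hmono
  have hev := (hRV.comp (tendsto_pow_atTop_atTop_of_one_lt (by norm_num : (1 : ℝ) < 2))).eventually
    (gt_mem_nhds ((le_max_left l 0).trans_lt hc))
  obtain ⟨K₀, hK₀⟩ := eventually_atTop.1 hev
  set K := max K₀ (N₁ : ℕ) with hK
  have hfl : ∀ k : ℕ, realTail f ((2 : ℝ) ^ k) = envelopeTail f (2 ^ k) := fun k => by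
    rw [realTail]
    congr 1
    exact_mod_cast Nat.floor_natCast (R := ℝ) (2 ^ k)
  have hstep : ∀ i : ℕ, envelopeTail f (2 ^ (K + i)) ≤ envelopeTail f (2 ^ K) * c ^ i := by
    intro i
    induction i with
    | zero => simp
    | succ i ih =>
      have h1 := hK₀ (K + i) ((le_max_left _ _).trans (Nat.le_add_right _ _))
      simp only [Function.comp] at h1
      rw [div_lt_iff₀ (realTail_pos hf _), ← pow_succ, hfl, hfl] at h1
      rw [← add_assoc, pow_succ c i]
      nlinarith
  have hc2 : 0 < c / 2 := by linarith
  set C₁ := envelopeTail f (2 ^ K) / (c / 2) * (c / 2)⁻¹ ^ K with hC₁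
  have hC₁0 : 0 < C₁ := by
    have := envelopeTail_pos hf (2 ^ K)
    positivity
  refine ⟨c, C₁ + (c / 2)⁻¹ ^ K, hc0, hc1, by positivity, fun a => ?_⟩
  rcases le_or_gt (Nat.log 2 a) K with hak | hak
  · have h2 : (1 : ℝ) ≤ (c / 2)⁻¹ ^ K * (c / 2) ^ Nat.log 2 a := by
      rw [inv_pow, inv_mul_eq_div, one_le_div (by positivity)]
      exact pow_le_pow_of_le_one hc2.le (by linarith) hak
    have h3 : 0 ≤ C₁ * (c / 2) ^ Nat.log 2 a := by positivity
    have := hf.le_one a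
    rw [add_mul]
    linarith
  · obtain ⟨i, hi⟩ : ∃ i, Nat.log 2 a = K + i + 1 := ⟨Nat.log 2 a - K - 1, by omega⟩
    have ha2 : 2 ^ (K + i + 1) ≤ (a : ℕ) := hi ▸ Nat.pow_log_le_self 2 a.ne_zero
    -- the `2 ^ (K + i)` symbols in `(2 ^ (K + i), 2 ^ (K + i + 1)]` have envelope at least `f a`
    set A : Finset ℕ+ := (Finset.Ioc (2 ^ (K + i)) (2 ^ (K + i + 1))).image Nat.toPNat' with hA
    have hmem : ∀ j ∈ A, 2 ^ (K + i) < (j : ℕ) ∧ (j : ℕ) ≤ 2 ^ (K + i + 1) := by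
      intro j hj
      obtain ⟨b, hb, rfl⟩ := Finset.mem_image.1 hj
      rw [Finset.mem_Ioc] at hb
      rwa [Nat.toPNat'_coe, if_pos (by omega)]
    have hcard : A.card = 2 ^ (K + i) := by
      rw [hA, Finset.card_image_of_injOn, Nat.card_Ioc, pow_succ]
      · omega
      · intro b hb b' hb' h
        rw [Finset.coe_Ioc, Set.mem_Ioc] at hb hb'
        have h := congrArg (fun a : ℕ+ => (a : ℕ)) h
        simpa [Nat.toPNat'_coe, (by omega : 0 < b), (by omega : 0 < b')] using h
    have h1 : ∀ j ∈ A, f a ≤ f j := by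
      intro j hj
      obtain ⟨h2, h3⟩ := hmem j hj
      have h4 : N₁ ≤ j := by
        rw [← PNat.coe_le_coe]
        have h5 : K + i < 2 ^ (K + i) := Nat.lt_two_pow_self
        have h6 : (N₁ : ℕ) ≤ K := le_max_right _ _
        omega
      have h7 : j ≤ a := by
        rw [← PNat.coe_le_coe]; omega
      exact hN₁ h4 (h4.trans h7) h7
    have h2 := (Finset.card_nsmul_le_sum _ _ _ h1).trans
      (sum_le_envelopeTail hf A fun j hj => (hmem j hj).1)
    rw [hcard, nsmul_eq_mul] at h2
    push_cast at h2
    have h3 := h2.trans (hstep i)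
    have h4 : f a ≤ C₁ * (c / 2) ^ Nat.log 2 a := by
      rw [hi, hC₁]
      have h5 : envelopeTail f (2 ^ K) / (c / 2) * (c / 2)⁻¹ ^ K * (c / 2) ^ (K + i + 1)
          = envelopeTail f (2 ^ K) * (c / 2) ^ i := by
        rw [pow_succ, pow_add, inv_pow]
        field_simp
      rw [h5, div_pow, ← mul_div_assoc, le_div_iff₀ (by positivity)]
      refine le_trans ?_ h3
      rw [mul_comm]
      refine mul_le_mul_of_nonneg_right ?_ (hf.pos a).le
      exact pow_le_pow_right₀ (by norm_num) (Nat.le_add_left _ _)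
    have h5 : 0 ≤ (c / 2)⁻¹ ^ K * (c / 2) ^ Nat.log 2 a := by positivity
    rw [add_mul]
    linarith

/-- The Elias codeword of a redacted symbol `a` is at most `log (1 / f a)` bits long, up to a
constant. -/
theorem exists_log_add_eliasLength_le {f : ℕ+ → ℝ} (hf : IsEnvelope f)
    (hmono : UltimatelyNonincreasing f) {l : ℝ} (hl : l < 1)
    (hRV : Tendsto (fun t => realTail f (t * 2) / realTail f t) atTop (𝓝 l)) :
    ∃ C, ∀ (a : ℕ+) (M : ℕ), M < (a : ℕ) →
      Real.log (f a) + eliasLength ((a : ℕ) - M + 1) * Real.log 2 ≤ C := by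
  obtain ⟨c, C, hc0, hc1, hC, hfa⟩ := exists_le_mul_pow_log hf hmono hl hRV
  obtain ⟨B, hB⟩ := (tendsto_pow_const_mul_const_pow_of_abs_lt_one 2
    (r := c) (by rwa [abs_of_pos hc0])).bddAbove_range
  refine ⟨Real.log (C * 16 * (B / c ^ 2)), fun a M _ => ?_⟩
  set k := Nat.log 2 a with hk
  have h1 : (a : ℕ) - M + 1 < 2 ^ (k + 2) := by
    have h2 : (a : ℕ) < 2 ^ (k + 1) := Nat.lt_pow_succ_log_self (by norm_num) _
    rw [pow_succ]
    omega
  have h2 : ((2 : ℝ) ^ eliasLength ((a : ℕ) - M + 1)) ≤ (2 * (k + 2)) ^ 2 * 2 ^ (k + 2) := by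
    exact_mod_cast two_pow_eliasLength_le (by omega) h1
  have h3 := hB (Set.mem_range_self (k + 2))
  rw [← Real.log_pow, ← Real.log_mul (hf.pos a).ne' (by positivity)]
  refine Real.log_le_log (mul_pos (hf.pos a) (by positivity)) ?_
  refine (mul_le_mul (hfa a) h2 (by positivity) (by positivity)).trans ?_
  calc C * (c / 2) ^ k * ((2 * (k + 2)) ^ 2 * 2 ^ (k + 2))
      = C * 16 * ((((k + 2 : ℕ) : ℝ) ^ 2 * c ^ (k + 2)) / c ^ 2) := by
        push_cast
        rw [div_pow]
        field_simp
        ring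
    _ ≤ C * 16 * (B / c ^ 2) := by gcongr

/-! ### Expected number of redactions and expected threshold -/

/-- The message as a list of natural numbers. -/
def word {n : ℕ} (x : Fin n → ℕ+) : List ℕ := List.ofFn fun i => (x i : ℕ)

theorem countP_take_ofFn {n : ℕ} (v : Fin n → ℕ) (i a : ℕ) :
    ((List.ofFn v).take i).countP (fun y => decide (a < y))
      = ∑ j : Fin n, if (j : ℕ) < i ∧ a < v j then 1 else 0 := by
  induction n generalizing i with
  | zero => simp
  | succ n ih =>
    rw [List.ofFn_succ, Fin.sum_univ_succ]
    cases i with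
    | zero => simp
    | succ i =>
      rw [List.take_succ_cons, List.countP_cons, ih, add_comm]
      simp

theorem pathSum_ofFn (c : List ℕ → ℕ → ℝ) {n : ℕ} (v : Fin n → ℕ) (h : List ℕ) :
    pathSum c h (List.ofFn v) = ∑ i : Fin n, c (h ++ (List.ofFn v).take i) (v i) := by
  induction n generalizing h with
  | zero => simp [pathSum]
  | succ n ih =>
    rw [List.ofFn_succ, pathSum, ih, Fin.sum_univ_succ]
    simp

theorem toMeasure_lt_le {f : ℕ+ → ℝ} (hf : IsEnvelope f) {P : PMF ℕ+} (hP : P ∈ envelopeClass f)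
    (k : ℕ) : P.toMeasure {a | k < (a : ℕ)} ≤ ENNReal.ofReal (envelopeTail f k) := by
  rw [PMF.toMeasure_apply _ MeasurableSet.of_discrete, envelopeTail,
    ENNReal.ofReal_tsum_of_nonneg (fun j => by
      split_ifs
      exacts [(hf.pos j).le, le_rfl]) (summable_tail_term hf k)]
  refine ENNReal.tsum_le_tsum fun j => ?_
  by_cases h : k < (j : ℕ)
  · simpa [Set.indicator, h] using hP j
  · simp [Set.indicator, h]

theorem lintegral_countP_le {f : ℕ+ → ℝ} (hf : IsEnvelope f) {P : PMF ℕ+}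
    (hP : P ∈ envelopeClass f) (n i k : ℕ) :
    ∫⁻ x, (((word x).take i).countP (fun y => decide (k < y)) : ℝ≥0∞) ∂blockLaw P n
      ≤ i * ENNReal.ofReal (envelopeTail f k) := by
  have h1 : ∀ x : Fin n → ℕ+, (((word x).take i).countP (fun y => decide (k < y)) : ℝ≥0∞)
      = ∑ j : Fin n, if (j : ℕ) < i then {x : Fin n → ℕ+ | x j ∈ {a : ℕ+ | k < (a : ℕ)}}.indicator
          (1 : (Fin n → ℕ+) → ℝ≥0∞) x else 0 := by
    intro x
    rw [word, countP_take_ofFn]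
    push_cast
    refine Finset.sum_congr rfl fun j _ => ?_
    by_cases hj : (j : ℕ) < i <;> simp [hj, Set.indicator]
  simp_rw [h1]
  rw [lintegral_finsetSum _ (fun _ _ => Measurable.of_discrete)]
  calc _ ≤ ∑ j : Fin n, if (j : ℕ) < i then ENNReal.ofReal (envelopeTail f k) else 0 := by
        refine Finset.sum_le_sum fun j _ => ?_
        split_ifs
        · rw [lintegral_indicator_one MeasurableSet.of_discrete, blockLaw_eval]
          exact toMeasure_lt_le hf hP k
        · simp
    _ = (min n i : ℕ) * ENNReal.ofReal (envelopeTail f k) := by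
        rw [← Finset.sum_filter, Finset.sum_const, Fin.card_filter_val_lt, nsmul_eq_mul]
    _ ≤ _ := by
        gcongr
        exact min_le_right _ _

/-- A cutoff `k`, just above the effective alphabet size, such that `k` plus the expected number of
symbols beyond `k` is of the order of the effective alphabet size. -/
theorem mul_envelopeTail_le {f : ℕ+ → ℝ} (hf : IsEnvelope f) {m : ℕ} (hm : 1 ≤ m) :
    ∃ k : ℕ, 1 ≤ k ∧ (k : ℝ) + m * envelopeTail f k
      ≤ 2 * (1 + 1 / effectiveSize (realTail f) 1) * effectiveSize (realTail f) m := by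
  have hG := realTail_antitone hf
  have hpos := realTail_pos hf
  set T := effectiveSize (realTail f) with hT
  have h1 : T m < ((⌊T m⌋₊ + 1 : ℕ) : ℝ) := by exact_mod_cast Nat.lt_floor_add_one (T m)
  have h2 := mul_lt_of_effectiveSize_lt hG hpos h1
  rw [realTail, Nat.floor_natCast] at h2
  have h3 : (⌊T m⌋₊ : ℝ) ≤ T m := Nat.floor_le (effectiveSize_nonneg _)
  have h4 : 0 < T 1 := effectiveSize_pos hG hpos one_pos
  have h5 : 1 ≤ 1 / T 1 * T m := by
    rw [one_div, inv_mul_eq_div, one_le_div h4]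
    exact effectiveSize_mono hG hpos (by exact_mod_cast hm)
  refine ⟨⌊T m⌋₊ + 1, by omega, ?_⟩
  push_cast at h2 ⊢
  linarith

theorem lintegral_threshold_le {f : ℕ+ → ℝ} (hf : IsEnvelope f) {P : PMF ℕ+}
    (hP : P ∈ envelopeClass f) (n : ℕ) {i m : ℕ} (him : i ≤ m) (hm : 1 ≤ m) :
    ∫⁻ x, (threshold ((word x).take i) : ℝ≥0∞) ∂blockLaw P n
      ≤ ENNReal.ofReal (2 * (1 + 1 / effectiveSize (realTail f) 1)
          * effectiveSize (realTail f) m) := by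
  obtain ⟨k, hk1, hk⟩ := mul_envelopeTail_le hf hm
  calc _ ≤ ∫⁻ x, ((k : ℝ≥0∞) + (((word x).take i).countP (fun y => decide (k < y)) : ℝ≥0∞))
          ∂blockLaw P n := by
        refine lintegral_mono fun x => ?_
        rw [← Nat.cast_add]
        exact Nat.cast_le.2 (threshold_le_add_countP _ hk1)
    _ = k + ∫⁻ x, (((word x).take i).countP (fun y => decide (k < y)) : ℝ≥0∞) ∂blockLaw P n := by
        rw [lintegral_add_left measurable_const]
        simp
    _ ≤ k + m * ENNReal.ofReal (envelopeTail f k) := by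
        gcongr
        refine (lintegral_countP_le hf hP n i k).trans ?_
        gcongr
    _ = ENNReal.ofReal (k + m * envelopeTail f k) := by
        have := (envelopeTail_pos hf k).le
        rw [ENNReal.ofReal_add (by positivity) (by positivity),
          ENNReal.ofReal_mul (by positivity), ENNReal.ofReal_natCast, ENNReal.ofReal_natCast]
    _ ≤ _ := ENNReal.ofReal_le_ofReal hk

/-- The number of distinct symbols is at most `k` plus the number of symbols beyond `k`. -/
theorem lintegral_card_toFinset_le {f : ℕ+ → ℝ} (hf : IsEnvelope f) {P : PMF ℕ+}
    (hP : P ∈ envelopeClass f) {n : ℕ} (hn : 1 ≤ n) :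
    ∫⁻ x, ((word x).toFinset.card : ℝ≥0∞) ∂blockLaw P n
      ≤ ENNReal.ofReal (2 * (1 + 1 / effectiveSize (realTail f) 1)
          * effectiveSize (realTail f) n) := by
  obtain ⟨k, hk1, hk⟩ := mul_envelopeTail_le hf hn
  have hcard : ∀ l : List ℕ, (∀ a ∈ l, 1 ≤ a) →
      l.toFinset.card ≤ k + l.countP (fun y => decide (k < y)) := by
    intro l hl
    have h1 : l.toFinset ⊆ Finset.Icc 1 k ∪ (l.filter fun y => decide (k < y)).toFinset := by
      intro a ha
      rw [List.mem_toFinset] at ha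
      have := hl a ha
      rw [Finset.mem_union, Finset.mem_Icc, List.mem_toFinset, List.mem_filter, decide_eq_true_eq]
      by_cases hka : k < a
      · exact Or.inr ⟨ha, hka⟩
      · exact Or.inl ⟨this, by omega⟩
    refine (Finset.card_le_card h1).trans ((Finset.card_union_le _ _).trans ?_)
    rw [Nat.card_Icc, List.countP_eq_length_filter]
    have := List.toFinset_card_le (l.filter fun y => decide (k < y))
    omega
  calc _ ≤ ∫⁻ x, ((k : ℝ≥0∞) + (((word x).take n).countP (fun y => decide (k < y)) : ℝ≥0∞))
          ∂blockLaw P n := by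
        refine lintegral_mono fun x => ?_
        have h2 : (word x).take n = word x := List.take_of_length_le (by simp [word])
        rw [h2, ← Nat.cast_add]
        exact Nat.cast_le.2 (hcard (word x) fun a ha => by
          rw [word, List.mem_ofFn] at ha
          obtain ⟨i, rfl⟩ := ha
          exact (x i).pos)
    _ = k + ∫⁻ x, (((word x).take n).countP (fun y => decide (k < y)) : ℝ≥0∞) ∂blockLaw P n := by
        rw [lintegral_add_left measurable_const]
        simp
    _ ≤ k + n * ENNReal.ofReal (envelopeTail f k) := by
        gcongr
        exact lintegral_countP_le hf hP n n k
    _ = ENNReal.ofReal (k + n * envelopeTail f k) := by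
        have := (envelopeTail_pos hf k).le
        rw [ENNReal.ofReal_add (by positivity) (by positivity),
          ENNReal.ofReal_mul (by positivity), ENNReal.ofReal_natCast, ENNReal.ofReal_natCast]
    _ ≤ _ := ENNReal.ofReal_le_ofReal hk

theorem measurePreserving_comp_swap (P : PMF ℕ+) {n : ℕ} (i k : Fin n) :
    MeasurePreserving (fun x : Fin n → ℕ+ => x ∘ Equiv.swap i k) (blockLaw P n) (blockLaw P n) := by
  have h := measurePreserving_piCongrLeft (fun _ : Fin n => P.toMeasure) (Equiv.swap i k)
  have e : (MeasurableEquiv.piCongrLeft (fun _ : Fin n => ℕ+) (Equiv.swap i k) :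
      (Fin n → ℕ+) → Fin n → ℕ+) = fun x => x ∘ Equiv.swap i k := by
    funext x
    rw [MeasurableEquiv.coe_piCongrLeft]
    funext j
    have := Equiv.piCongrLeft_apply_apply (fun _ : Fin n => ℕ+) (Equiv.swap i k) x
      (Equiv.swap i k j)
    rw [Equiv.swap_apply_self] at this
    rw [this]
    rfl
  rw [e] at h
  exact h

/-- By exchangeability, the probability that the symbol at time `i` is redacted is the average over
the first `i + 1` positions of the leave-one-out events, hence at most `E M_{i+1} / (i + 1)`. -/
theorem mul_blockLaw_redacted_le (P : PMF ℕ+) {n : ℕ} (i : Fin n) :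
    ((i + 1 : ℕ) : ℝ≥0∞) * blockLaw P n {x | threshold ((word x).take i) < (x i : ℕ)}
      ≤ ∫⁻ x, (threshold ((word x).take (i + 1)) : ℝ≥0∞) ∂blockLaw P n := by
  set s : Finset (Fin n) := Finset.univ.filter fun k => (k : ℕ) < i + 1 with hs
  have hscard : s.card = i + 1 := by
    rw [hs, Fin.card_filter_val_lt]
    have := i.2
    omega
  -- the event that the symbol `k`, exchanged with the symbol `i`, is redacted at time `i`
  set E : Fin n → Set (Fin n → ℕ+) :=
    fun k => {x | threshold ((word (x ∘ Equiv.swap i k)).take i) < (x k : ℕ)} with hE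
  have hEk : ∀ k, blockLaw P n (E k)
      = blockLaw P n {x | threshold ((word x).take i) < (x i : ℕ)} := by
    intro k
    rw [← (measurePreserving_comp_swap P i k).measure_preimage
      (MeasurableSet.of_discrete.nullMeasurableSet)]
    congr 1
    ext x
    have hx : (x ∘ Equiv.swap i k) ∘ Equiv.swap i k = x := by funext j; simp
    simp [hE, hx]
  have hpt : ∀ x : Fin n → ℕ+, ∑ k ∈ s, (E k).indicator (1 : (Fin n → ℕ+) → ℝ≥0∞) x
      ≤ (threshold ((word x).take (i + 1)) : ℝ≥0∞) := by
    intro x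
    have h1 := card_leave_one_out_le s (fun k => (x k : ℕ))
      (fun k => (word (x ∘ Equiv.swap i k)).take i) ((word x).take (i + 1)) (by
        intro k _
        have := i.2
        simp [word]) (by
        intro k hk a
        rw [hs, Finset.mem_filter] at hk
        simp only [word, countP_take_ofFn, Function.comp]
        rw [← Equiv.sum_comp (Equiv.swap i k)]
        have h2 : ∀ j : Fin n, (if ((Equiv.swap i k j : Fin n) : ℕ) < i + 1 ∧
              a < (x (Equiv.swap i k j) : ℕ) then 1 else 0)
            = (if (j : ℕ) < i ∧ a < (x (Equiv.swap i k j) : ℕ) then 1 else 0)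
              + if j = i then (if a < (x k : ℕ) then 1 else 0) else 0 := by
          intro j
          by_cases hji : j = i
          · subst hji
            simp [Equiv.swap_apply_left, hk.2]
          · have h3 : (((Equiv.swap i k j : Fin n) : ℕ) < i + 1) ↔ (j : ℕ) < i := by
              have h4 : (j : ℕ) ≠ i := fun h => hji (Fin.ext h)
              by_cases hjk : j = k
              · subst hjk
                rw [Equiv.swap_apply_right]
                omega
              · rw [Equiv.swap_apply_of_ne_of_ne hji hjk]
                omega
            simp [hji, h3]
        rw [Finset.sum_congr rfl fun j _ => h2 j, Finset.sum_add_distrib, Finset.sum_ite_eq' _ i]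
        simp) (by
        intro a
        rw [word, countP_take_ofFn, Finset.card_filter, hs, Finset.sum_filter]
        refine Finset.sum_le_sum fun j _ => ?_
        by_cases hj : (j : ℕ) < i + 1 <;> simp [hj])
    rw [Finset.card_filter] at h1
    calc _ = ((∑ k ∈ s, if threshold ((word (x ∘ Equiv.swap i k)).take i) < (x k : ℕ)
            then 1 else 0 : ℕ) : ℝ≥0∞) := by
          push_cast
          refine Finset.sum_congr rfl fun k _ => ?_
          simp [hE, Set.indicator]
      _ ≤ _ := by exact_mod_cast h1
  calc _ = ∑ k ∈ s, blockLaw P n (E k) := by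
        rw [Finset.sum_congr rfl fun k _ => hEk k, Finset.sum_const, hscard, nsmul_eq_mul]
    _ = ∫⁻ x, ∑ k ∈ s, (E k).indicator (1 : (Fin n → ℕ+) → ℝ≥0∞) x ∂blockLaw P n := by
        rw [lintegral_finsetSum _ (fun _ _ => Measurable.of_discrete)]
        refine Finset.sum_congr rfl fun k _ => ?_
        rw [lintegral_indicator_one MeasurableSet.of_discrete]
    _ ≤ _ := lintegral_mono hpt

/-! ### An upper bound for the redundancy of the ETAC code -/

/-- On a countable space, a pointwise bound `G` for the log-likelihood ratio bounds the divergence by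
the mean of `G`. -/
theorem klDiv_le_lintegral {α : Type*} [MeasurableSpace α] [Countable α]
    [MeasurableSingletonClass α] (μ ν : Measure α) [IsProbabilityMeasure μ]
    [IsProbabilityMeasure ν] {G : α → ℝ} (hG : ∀ x, 0 ≤ G x)
    (h : ∀ x, μ {x} ≤ ENNReal.ofReal (Real.exp (G x)) * ν {x}) :
    InformationTheory.klDiv μ ν ≤ ∫⁻ x, ENNReal.ofReal (G x) ∂μ := by
  have hac : μ ≪ ν := by
    intro s hs
    rw [← Set.biUnion_of_singleton s, measure_biUnion_null_iff (Set.to_countable s)] at hs ⊢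
    intro x hx
    have := h x
    rwa [hs x hx, mul_zero, nonpos_iff_eq_zero] at this
  have hr : ∀ᵐ x ∂ν, μ.rnDeriv ν x ≤ ENNReal.ofReal (Real.exp (G x)) := by
    rw [ae_iff_of_countable]
    intro x hx
    have h1 := Measure.setLIntegral_rnDeriv hac {x}
    rw [lintegral_singleton] at h1
    have h2 := h x
    rw [← h1] at h2
    exact (ENNReal.mul_le_mul_iff_left hx (measure_ne_top ν _)).1 h2
  -- with `1 = ∫ t dν` added on the left, the bound is pointwise: `klFun t + t ≤ t * G + 1`
  have hmain : InformationTheory.klDiv μ ν + 1 ≤ ∫⁻ x, ENNReal.ofReal (G x) ∂μ + 1 := by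
    have e1 : ∫⁻ x, μ.rnDeriv ν x ∂ν = 1 := by rw [Measure.lintegral_rnDeriv hac]; simp
    have e2 : ∫⁻ x, ENNReal.ofReal (G x) ∂μ = ∫⁻ x, μ.rnDeriv ν x * ENNReal.ofReal (G x) ∂ν :=
      (lintegral_rnDeriv_mul hac (measurable_of_countable _).aemeasurable).symm
    have e3 : (1 : ℝ≥0∞) = ∫⁻ _, 1 ∂ν := by simp
    rw [InformationTheory.klDiv_eq_lintegral_klFun_of_ac hac, e2]
    nth_rewrite 1 [← e1]
    rw [e3, ← lintegral_add_right _ (Measure.measurable_rnDeriv μ ν),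
      ← lintegral_add_right _ measurable_const]
    refine lintegral_mono_ae ?_
    filter_upwards [hr] with x hx
    have hne : μ.rnDeriv ν x ≠ ∞ := ne_top_of_le_ne_top ENNReal.ofReal_ne_top hx
    set t := (μ.rnDeriv ν x).toReal with ht
    have ht0 : 0 ≤ t := ENNReal.toReal_nonneg
    have htr : μ.rnDeriv ν x = ENNReal.ofReal t := (ENNReal.ofReal_toReal hne).symm
    rw [htr] at hx ⊢
    have htG : t ≤ Real.exp (G x) := (ENNReal.ofReal_le_ofReal_iff (Real.exp_pos _).le).1 hx
    rw [← ENNReal.ofReal_add (InformationTheory.klFun_nonneg ht0) ht0, ← ENNReal.ofReal_mul ht0,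
      ← ENNReal.ofReal_one, ← ENNReal.ofReal_add (mul_nonneg ht0 (hG x)) zero_le_one]
    refine ENNReal.ofReal_le_ofReal ?_
    rw [InformationTheory.klFun_apply]
    rcases ht0.eq_or_lt with h0 | h0
    · rw [← h0]; simp
    · have := (Real.log_le_log h0 htG)
      rw [Real.log_exp] at this
      have := mul_le_mul_of_nonneg_left this ht0
      linarith
  exact (ENNReal.add_le_add_iff_right ENNReal.one_ne_top).1 hmain

/-- Normalization only increases the coding probability. -/
theorem pow_etacLength_le_etac {n : ℕ} (x : Fin n → ℕ+) :
    (2⁻¹ : ℝ≥0∞) ^ etacLength x ≤ etac n x := by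
  rw [etac, PMF.normalize_apply]
  refine le_mul_of_one_le_right (zero_le) ?_
  rw [ENNReal.one_le_inv]
  exact etacLength_kraft n

/-- The pointwise redundancy of the ETAC code is at most
`A * (#redacted + #distinct + 1) + ∑ M_{i-1} / i`. -/
theorem blockLaw_singleton_le {f : ℕ+ → ℝ} (hf : IsEnvelope f) {C : ℝ}
    (hC : ∀ (a : ℕ+) (M : ℕ), M < (a : ℕ) →
      Real.log (f a) + eliasLength ((a : ℕ) - M + 1) * Real.log 2 ≤ C)
    {P : PMF ℕ+} (hP : P ∈ envelopeClass f) {n : ℕ} {A : ℝ}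
    (hA : |C| + 2 * Real.log 2 + eliasLength 1 * Real.log 2 + 2 * Real.log (3 * n + 1) ≤ A)
    (x : Fin n → ℕ+) :
    blockLaw P n {x} ≤ ENNReal.ofReal (Real.exp
      (A * (pathSum redacted [] (word x) + (word x).toFinset.card + 1)
        + pathSum (fun h _ => (threshold h : ℝ) / ((h.length + 1 : ℕ) : ℝ)) [] (word x)))
        * (etac n).toMeasure {x} := by
  have hprod : blockLaw P n {x} = ∏ i, P (x i) := by
    rw [blockLaw, Measure.pi_singleton]
    exact Finset.prod_congr rfl fun i _ =>
      PMF.toMeasure_apply_singleton _ _ (MeasurableSet.singleton _)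
  rw [hprod, PMF.toMeasure_apply_singleton _ _ (MeasurableSet.singleton _)]
  by_cases hzero : ∃ i, P (x i) = 0
  · obtain ⟨i, hi⟩ := hzero
    rw [Finset.prod_eq_zero (Finset.mem_univ i) hi]
    exact zero_le
  push Not at hzero
  -- the marginal extended by zero to all natural numbers
  set p : ℕ → ℝ := fun a => if h : 0 < a then (P ⟨a, h⟩).toReal else 0 with hp
  have hpa : ∀ a : ℕ+, p a = (P a).toReal := fun a => by
    simp only [hp, a.pos, dif_pos]
    rfl
  have hp0 : ∀ a, 0 ≤ p a := by
    intro a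
    simp only [hp]
    split_ifs
    exacts [ENNReal.toReal_nonneg, le_rfl]
  have hPle : ∀ a, P a ≤ 1 := fun a => P.coe_le_one a
  have hpf : ∀ a : ℕ+, p a ≤ f a := by
    intro a
    rw [hpa]
    exact ENNReal.toReal_le_of_le_ofReal (hf.pos a).le (hP a)
  have hsum : ∀ S : Finset ℕ, ∑ j ∈ S, p j ≤ 1 := by
    intro S
    have h1 : ∑ j ∈ S, p j ≤ ∑ a ∈ S.image Nat.toPNat', (P a).toReal := by
      have h2 : ∑ j ∈ S, p j = ∑ j ∈ S.filter (0 < ·), (P (Nat.toPNat' j)).toReal := by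
        rw [Finset.sum_filter]
        refine Finset.sum_congr rfl fun j _ => ?_
        simp only [hp]
        split_ifs with h
        · congr 2
          apply PNat.eq
          simp [Nat.toPNat'_coe, h]
        · rfl
      rw [h2, ← Finset.sum_image (s := S.filter (0 < ·)) (g := Nat.toPNat')
        (f := fun a => (P a).toReal)]
      · exact Finset.sum_le_sum_of_subset_of_nonneg
          (Finset.image_subset_image (Finset.filter_subset _ _))
          fun a _ _ => ENNReal.toReal_nonneg
      · intro b hb b' hb' h
        have hb := (Finset.mem_filter.1 hb).2
        have hb' := (Finset.mem_filter.1 hb').2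
        have h := congrArg (fun a : ℕ+ => (a : ℕ)) h
        simpa [Nat.toPNat'_coe, hb, hb'] using h
    refine h1.trans ?_
    rw [← ENNReal.toReal_sum fun a _ => P.apply_ne_top a]
    refine ENNReal.toReal_le_of_le_ofReal zero_le_one ?_
    rw [ENNReal.ofReal_one, ← P.tsum_coe]
    exact ENNReal.sum_le_tsum _
  have hCp : ∀ a M, M < a → 0 < p a →
      Real.log (p a) + eliasLength (a - M + 1) * Real.log 2 ≤ |C| := by
    intro a M hM hpa0
    obtain ⟨b, rfl⟩ : ∃ b : ℕ+, (b : ℕ) = a := ⟨⟨a, by omega⟩, rfl⟩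
    have := Real.log_le_log hpa0 (hpf b)
    have := hC b M hM
    have := le_abs_self C
    linarith
  have hlpos : ∀ a ∈ word x, 1 ≤ a ∧ 0 < p a := by
    intro a ha
    rw [word, List.mem_ofFn] at ha
    obtain ⟨i, rfl⟩ := ha
    refine ⟨(x i).pos, ?_⟩
    rw [hpa]
    exact ENNReal.toReal_pos (hzero i) (P.apply_ne_top _)
  have hmain := encoderBits_add_log_le hp0 hsum hCp hlpos
  have hlen : (word x).length = n := by simp [word]
  rw [hlen] at hmain
  set R := pathSum redacted [] (word x) with hR
  set D : ℝ := ((word x).toFinset.card : ℝ) with hD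
  set Mw := pathSum (fun h _ => (threshold h : ℝ) / ((h.length + 1 : ℕ) : ℝ)) [] (word x) with hMw
  have hR0 : 0 ≤ R := by
    rw [hR, word, pathSum_ofFn]
    refine Finset.sum_nonneg fun i _ => ?_
    unfold redacted
    split_ifs <;> norm_num
  have hD0 : 0 ≤ D := Nat.cast_nonneg _
  have hn0 : (0 : ℝ) ≤ n := Nat.cast_nonneg _
  have hl2 : 0 < Real.log 2 := Real.log_pos (by norm_num)
  have hl3 : 0 ≤ Real.log (3 * n + 1) := Real.log_nonneg (by linarith)
  have hln : Real.log n ≤ Real.log (3 * n + 1) := by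
    rcases hn0.eq_or_lt with h | h
    -- for the empty message, `Real.log 0 = 0`
    · rw [← h, Real.log_zero]; simp
    · exact Real.log_le_log h (by linarith)
  have hln1 : Real.log (n + 1) ≤ Real.log (3 * n + 1) := Real.log_le_log (by linarith) (by linarith)
  have hel : 0 ≤ eliasLength 1 * Real.log 2 := by positivity
  have hCa := abs_nonneg C
  have hbound : etacLength x * Real.log 2 + ((word x).map fun a => Real.log (p a)).sum
      ≤ A * (R + D + 1) + Mw := by
    have h1 : (|C| + Real.log n + Real.log (3 * n + 1) + 2 * Real.log 2) * R ≤ A * R :=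
      mul_le_mul_of_nonneg_right (by linarith) hR0
    have h2 : D * Real.log (n + 1) ≤ A * D := by
      rw [mul_comm]
      exact mul_le_mul_of_nonneg_right (by linarith) hD0
    have h3 : encoderBits [] 1 (word x) = etacLength x := rfl
    rw [h3] at hmain
    linarith
  have hP' : ∏ i, P (x i)
      = ENNReal.ofReal (Real.exp ((word x).map fun a => Real.log (p a)).sum) := by
    rw [word, List.map_ofFn, List.sum_ofFn, Real.exp_sum,
      ENNReal.ofReal_prod_of_nonneg (fun i _ => (Real.exp_pos _).le)]
    refine Finset.prod_congr rfl fun i _ => ?_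
    simp only [Function.comp]
    rw [hpa, Real.exp_log (ENNReal.toReal_pos (hzero i) (P.apply_ne_top _)),
      ENNReal.ofReal_toReal (P.apply_ne_top _)]
  have hE : (2⁻¹ : ℝ≥0∞) ^ etacLength x
      = ENNReal.ofReal (Real.exp (-(etacLength x * Real.log 2))) := by
    rw [Real.exp_neg, mul_comm, Real.exp_mul, Real.exp_log two_pos, Real.rpow_natCast,
      ENNReal.ofReal_inv_of_pos (by positivity), ENNReal.ofReal_pow zero_le_two, ENNReal.inv_pow]
    simp
  refine le_trans ?_ (mul_le_mul' le_rfl (pow_etacLength_le_etac x))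
  rw [hP', hE, ← ENNReal.ofReal_mul (Real.exp_pos _).le, ← Real.exp_add]
  refine ENNReal.ofReal_le_ofReal (Real.exp_le_exp.2 ?_)
  linarith

/-- The redundancy of the ETAC code is at most of the order of `log n` times the effective alphabet
size. -/
theorem exists_maximalRedundancy_etac_le {f : ℕ+ → ℝ} (hf : IsEnvelope f)
    (hmono : UltimatelyNonincreasing f) {α : ℝ} (hα : 0 < α)
    (hRV : ∀ y, 0 < y →
      Tendsto (fun t => realTail f (t * y) / realTail f t) atTop (𝓝 (y ^ (-α)))) :
    ∃ K, 0 < K ∧ ∀ n : ℕ, 2 ≤ n → maximalRedundancy (etac n) (envelopeClass f)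
      ≤ ENNReal.ofReal (K * Real.logb 2 n * effectiveSize (realTail f) n) := by
  have hG := realTail_antitone hf
  have hGpos := realTail_pos hf
  obtain ⟨C, hC⟩ := exists_log_add_eliasLength_le hf hmono
    (Real.rpow_lt_one_of_one_lt_of_neg (by norm_num) (by linarith)) (hRV 2 two_pos)
  set T := effectiveSize (realTail f) with hT
  have hTmono : Monotone T := effectiveSize_mono hG hGpos
  have hTpos : ∀ s, 0 < s → 0 < T s := fun s hs => effectiveSize_pos hG hGpos hs
  obtain ⟨B, hB, hsumB⟩ := sum_div_le hTmono hTpos (fun s => effectiveSize_nonneg s)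
    (Real.rpow_lt_one (by norm_num) (by norm_num) (show 0 < 1 / (1 + α) by positivity))
    (effectiveSize_regularlyVarying hG hGpos hα hRV (x := 1 / 2) (by norm_num))
  have hT1 : 0 < T 1 := hTpos 1 one_pos
  set c₁ : ℝ := 2 * (1 + 1 / T 1) with hc₁
  have hc₁0 : 0 < c₁ := by positivity
  have hl2 : 0 < Real.log 2 := Real.log_pos (by norm_num)
  set c₀ : ℝ := |C| + 2 * Real.log 2 + eliasLength 1 * Real.log 2 with hc₀
  have hc₀0 : 0 ≤ c₀ := by positivity
  set c₂ : ℝ := c₀ / Real.log 2 + 6 with hc₂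
  have hc₂0 : 0 < c₂ := by positivity
  refine ⟨c₂ * (c₁ * B + c₁ + 1 / T 1) + c₁ * B / Real.log 2, by positivity, fun n hn => ?_⟩
  have hn0 : (0 : ℝ) < n := by exact_mod_cast (by omega : 0 < n)
  have hn2 : (2 : ℝ) ≤ n := by exact_mod_cast hn
  have hTn : 0 < T n := hTpos _ hn0
  have hlog2n : Real.log 2 ≤ Real.log n := Real.log_le_log two_pos hn2
  set A : ℝ := c₂ * Real.log n with hA
  have hA0 : 0 ≤ A := mul_nonneg hc₂0.le (hl2.le.trans hlog2n)
  have hA1 : c₀ + 2 * Real.log (3 * n + 1) ≤ A := by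
    have h1 : Real.log (3 * n + 1) ≤ 3 * Real.log n := by
      rw [show (3 : ℝ) * Real.log n = Real.log ((n : ℝ) ^ 3) by rw [Real.log_pow]; norm_num]
      refine Real.log_le_log (by linarith) ?_
      nlinarith [mul_nonneg (sub_nonneg.2 hn2) hn0.le, mul_pos hn0 hn0]
    have h2 : c₀ ≤ c₀ / Real.log 2 * Real.log n := by
      rw [div_mul_eq_mul_div, le_div_iff₀ hl2]
      exact mul_le_mul_of_nonneg_left hlog2n hc₀0
    rw [hA, hc₂]
    linarith
  refine iSup₂_le fun P hP => ?_
  have hred : ∀ i : Fin n, blockLaw P n {x | threshold ((word x).take i) < (x i : ℕ)}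
      ≤ ENNReal.ofReal (c₁ * (T ((i + 1 : ℕ) : ℝ) / ((i + 1 : ℕ) : ℝ))) := by
    intro i
    have h1 := (mul_blockLaw_redacted_le P i).trans
      (lintegral_threshold_le hf hP n (le_refl ((i : ℕ) + 1)) (by omega))
    rw [mul_comm, ← ENNReal.le_div_iff_mul_le (Or.inl (by simp)) (Or.inl (by simp))] at h1
    rwa [← ENNReal.ofReal_natCast, ← ENNReal.ofReal_div_of_pos (by positivity), mul_div_assoc]
      at h1
  have hsumc : ∑ i : Fin n, c₁ * (T ((i + 1 : ℕ) : ℝ) / ((i + 1 : ℕ) : ℝ)) ≤ c₁ * B * T n := by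
    rw [← Finset.mul_sum, mul_assoc c₁ B,
      Fin.sum_univ_eq_sum_range (fun i : ℕ => T ((i + 1 : ℕ) : ℝ) / ((i + 1 : ℕ) : ℝ))]
    exact mul_le_mul_of_nonneg_left (hsumB n (by omega)) hc₁0.le
  have hterm0 : ∀ i : Fin n, 0 ≤ c₁ * (T ((i + 1 : ℕ) : ℝ) / ((i + 1 : ℕ) : ℝ)) := fun i =>
    mul_nonneg hc₁0.le (div_nonneg (effectiveSize_nonneg _) (Nat.cast_nonneg _))
  have hER : ∫⁻ x, ENNReal.ofReal (pathSum redacted [] (word x)) ∂blockLaw P n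
      ≤ ENNReal.ofReal (c₁ * B * T n) := by
    have e : ∀ x : Fin n → ℕ+, ENNReal.ofReal (pathSum redacted [] (word x))
        = ∑ i : Fin n, {x : Fin n → ℕ+ | threshold ((word x).take i) < (x i : ℕ)}.indicator
          (1 : (Fin n → ℕ+) → ℝ≥0∞) x := by
      intro x
      rw [word, pathSum_ofFn, ENNReal.ofReal_sum_of_nonneg]
      · refine Finset.sum_congr rfl fun i _ => ?_
        rw [redacted, List.nil_append]
        by_cases h : (x i : ℕ) ≤ threshold ((List.ofFn fun i => (x i : ℕ)).take i)
        · rw [if_pos h, Set.indicator_of_notMem (by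
            rw [Set.mem_ofPred_eq, not_lt]; exact h)]
          simp
        · rw [if_neg h, Set.indicator_of_mem (by
            rw [Set.mem_ofPred_eq]; exact not_le.1 h)]
          simp
      · intro i _
        unfold redacted
        split_ifs <;> norm_num
    simp_rw [e]
    rw [lintegral_finsetSum _ (fun _ _ => Measurable.of_discrete)]
    refine le_trans (Finset.sum_le_sum fun i _ => ?_)
      ((ENNReal.ofReal_sum_of_nonneg fun i _ => hterm0 i).symm.le.trans
        (ENNReal.ofReal_le_ofReal hsumc))
    rw [lintegral_indicator_one MeasurableSet.of_discrete]
    exact hred i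
  have hEM : ∫⁻ x, ENNReal.ofReal (pathSum (fun h _ => (threshold h : ℝ) /
      ((h.length + 1 : ℕ) : ℝ)) [] (word x)) ∂blockLaw P n ≤ ENNReal.ofReal (c₁ * B * T n) := by
    have e : ∀ x : Fin n → ℕ+, ENNReal.ofReal (pathSum (fun h _ => (threshold h : ℝ) /
        ((h.length + 1 : ℕ) : ℝ)) [] (word x))
        = ∑ i : Fin n, (threshold ((word x).take i) : ℝ≥0∞) * (((i : ℕ) + 1 : ℕ) : ℝ≥0∞)⁻¹ := by
      intro x
      rw [word, pathSum_ofFn, ENNReal.ofReal_sum_of_nonneg (fun i _ => by positivity)]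
      refine Finset.sum_congr rfl fun i _ => ?_
      have h1 : (([] : List ℕ) ++ (List.ofFn fun i => (x i : ℕ)).take i).length = i := by
        simp [i.2.le]
      rw [h1, List.nil_append, ENNReal.ofReal_div_of_pos (by positivity), ENNReal.ofReal_natCast,
        ENNReal.ofReal_natCast, div_eq_mul_inv]
    simp_rw [e]
    rw [lintegral_finsetSum _ (fun _ _ => Measurable.of_discrete)]
    refine le_trans (Finset.sum_le_sum fun i _ => ?_)
      ((ENNReal.ofReal_sum_of_nonneg fun i _ => hterm0 i).symm.le.trans
        (ENNReal.ofReal_le_ofReal hsumc))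
    rw [lintegral_mul_const _ Measurable.of_discrete]
    refine (mul_le_mul' (lintegral_threshold_le hf hP n (Nat.le_succ (i : ℕ)) (by omega))
      le_rfl).trans ?_
    rw [← div_eq_mul_inv, ← ENNReal.ofReal_natCast, ← ENNReal.ofReal_div_of_pos (by positivity),
      mul_div_assoc]
  have hkl := klDiv_le_lintegral (blockLaw P n) (etac n).toMeasure
    (G := fun x => A * (pathSum redacted [] (word x) + (word x).toFinset.card + 1)
        + pathSum (fun h _ => (threshold h : ℝ) / ((h.length + 1 : ℕ) : ℝ)) [] (word x))
    (fun x => by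
      rw [word, pathSum_ofFn, pathSum_ofFn]
      have h1 : 0 ≤ ∑ i : Fin n, redacted ([] ++ (List.ofFn fun i => (x i : ℕ)).take i) (x i) := by
        refine Finset.sum_nonneg fun i _ => ?_
        unfold redacted
        split_ifs <;> norm_num
      positivity)
    (fun x => blockLaw_singleton_le hf hC hP hA1 x)
  have hG' : ∫⁻ x, ENNReal.ofReal (A * (pathSum redacted [] (word x) + (word x).toFinset.card + 1)
        + pathSum (fun h _ => (threshold h : ℝ) / ((h.length + 1 : ℕ) : ℝ)) [] (word x))
        ∂blockLaw P n
      ≤ ENNReal.ofReal (A * (c₁ * B * T n + c₁ * T n + 1) + c₁ * B * T n) := by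
    have h1 : ∀ x : Fin n → ℕ+,
        ENNReal.ofReal (A * (pathSum redacted [] (word x) + (word x).toFinset.card + 1)
          + pathSum (fun h _ => (threshold h : ℝ) / ((h.length + 1 : ℕ) : ℝ)) [] (word x))
        ≤ ENNReal.ofReal A * (ENNReal.ofReal (pathSum redacted [] (word x))
            + ((word x).toFinset.card : ℝ≥0∞) + 1)
          + ENNReal.ofReal
            (pathSum (fun h _ => (threshold h : ℝ) / ((h.length + 1 : ℕ) : ℝ)) [] (word x)) := by
      intro x
      refine ENNReal.ofReal_add_le.trans (add_le_add_left ?_ _)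
      rw [ENNReal.ofReal_mul hA0]
      refine mul_le_mul' le_rfl (ENNReal.ofReal_add_le.trans (add_le_add ?_ (by simp)))
      refine ENNReal.ofReal_add_le.trans ?_
      rw [ENNReal.ofReal_natCast]
    refine (lintegral_mono h1).trans ?_
    rw [lintegral_add_right _ Measurable.of_discrete, lintegral_const_mul _ Measurable.of_discrete,
      lintegral_add_right _ Measurable.of_discrete, lintegral_add_right _ Measurable.of_discrete]
    have h2 := lintegral_card_toFinset_le hf hP (n := n) (by omega)
    have h3 : ∫⁻ _, (1 : ℝ≥0∞) ∂blockLaw P n = ENNReal.ofReal 1 := by simp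
    rw [h3]
    refine (add_le_add (mul_le_mul' le_rfl (add_le_add (add_le_add hER h2) le_rfl)) hEM).trans ?_
    rw [← hT, ← hc₁, ← ENNReal.ofReal_add (by positivity) (by positivity),
      ← ENNReal.ofReal_add (by positivity) (by positivity), ← ENNReal.ofReal_mul hA0,
      ← ENNReal.ofReal_add (by positivity) (by positivity)]
  rw [klBits]
  refine (ENNReal.div_le_div_right (hkl.trans hG') _).trans ?_
  rw [← ENNReal.ofReal_div_of_pos hl2]
  refine ENNReal.ofReal_le_ofReal ?_
  rw [div_le_iff₀ hl2, Real.logb]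
  have h4 : 1 ≤ 1 / T 1 * T n := by
    rw [one_div, inv_mul_eq_div, one_le_div hT1]
    exact hTmono (by linarith)
  have h5 : A * (c₁ * B * T n + c₁ * T n + 1) ≤ A * ((c₁ * B + c₁ + 1 / T 1) * T n) :=
    mul_le_mul_of_nonneg_left (by linarith) hA0
  have h6 : c₁ * B * T n ≤ c₁ * B / Real.log 2 * Real.log n * T n := by
    refine mul_le_mul_of_nonneg_right ?_ hTn.le
    rw [div_mul_eq_mul_div, le_div_iff₀ hl2]
    exact mul_le_mul_of_nonneg_left hlog2n (by positivity)
  have h7 : (c₂ * (c₁ * B + c₁ + 1 / T 1) + c₁ * B / Real.log 2) * (Real.log n / Real.log 2) * T n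
      * Real.log 2 = A * ((c₁ * B + c₁ + 1 / T 1) * T n)
        + c₁ * B / Real.log 2 * Real.log n * T n := by
    rw [hA]
    field_simp
  rw [h7]
  linarith

/-! ### Growth exponents -/

theorem tendsto_log_logb_div_log :
    Tendsto (fun n : ℕ => Real.log (Real.logb 2 n) / Real.log n) atTop (𝓝 0) := by
  have hl2 : 0 < Real.log 2 := Real.log_pos (by norm_num)
  have h1 : Tendsto (fun n : ℕ => Real.logb 2 n) atTop atTop :=
    (Real.tendsto_logb_atTop (by norm_num)).comp tendsto_natCast_atTop_atTop
  have h2 : Tendsto (fun y : ℝ => Real.log y / y) atTop (𝓝 0) :=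
    Real.isLittleO_log_id_atTop.tendsto_div_nhds_zero
  have h3 := (h2.comp h1).mul_const (Real.log 2)⁻¹
  rw [zero_mul] at h3
  refine h3.congr fun n => ?_
  simp only [Function.comp]
  conv_lhs => rw [Real.logb]
  conv_rhs => rw [Real.logb]
  field_simp

/-- Two-sided bounds that differ by a factor `O(log n)` determine the growth exponent. -/
theorem tendsto_log_toReal_div_log {T : ℕ → ℝ} {R : ℕ → ℝ≥0∞} {κ K ρ : ℝ} (hκ : 0 < κ)
    (hK : 0 < K) (hT : ∀ n, 1 ≤ n → 0 < T n)
    (hlim : Tendsto (fun n : ℕ => Real.log (T n) / Real.log n) atTop (𝓝 ρ))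
    (hlow : ∀ n : ℕ, 1 ≤ n → ENNReal.ofReal (κ * T n) ≤ R n)
    (hup : ∀ n : ℕ, 2 ≤ n → R n ≤ ENNReal.ofReal (K * Real.logb 2 n * T n)) :
    Tendsto (fun n : ℕ => Real.log (R n).toReal / Real.log n) atTop (𝓝 ρ) := by
  have hlogtop : Tendsto (fun n : ℕ => Real.log n) atTop atTop :=
    Real.tendsto_log_atTop.comp tendsto_natCast_atTop_atTop
  have hc : ∀ c : ℝ, Tendsto (fun n : ℕ => c / Real.log n) atTop (𝓝 0) := fun c =>
    tendsto_const_nhds.div_atTop hlogtop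
  have h1 := (hc (Real.log κ)).add hlim
  have h2 := ((hc (Real.log K)).add tendsto_log_logb_div_log).add hlim
  rw [zero_add] at h1
  rw [zero_add, zero_add] at h2
  refine tendsto_of_tendsto_of_tendsto_of_le_of_le' h1 h2 ?_ ?_
  · filter_upwards [eventually_ge_atTop 2] with n hn
    have hTn := hT n (by omega)
    have hn2 : (2 : ℝ) ≤ n := by exact_mod_cast hn
    have hne : R n ≠ ∞ := ne_top_of_le_ne_top ENNReal.ofReal_ne_top (hup n hn)
    rw [← add_div, ← Real.log_mul hκ.ne' hTn.ne']
    refine div_le_div_of_nonneg_right ?_ (Real.log_nonneg (by linarith))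
    exact Real.log_le_log (by positivity) ((ENNReal.ofReal_le_iff_le_toReal hne).1
      (hlow n (by omega)))
  · filter_upwards [eventually_ge_atTop 2] with n hn
    have hTn := hT n (by omega)
    have hn2 : (2 : ℝ) ≤ n := by exact_mod_cast hn
    have hne : R n ≠ ∞ := ne_top_of_le_ne_top ENNReal.ofReal_ne_top (hup n hn)
    have hlb : 0 < Real.logb 2 n := Real.logb_pos (by norm_num) (by linarith)
    rw [← add_div, ← add_div, ← Real.log_mul hK.ne' hlb.ne',
      ← Real.log_mul (by positivity) hTn.ne']
    refine div_le_div_of_nonneg_right ?_ (Real.log_nonneg (by linarith))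
    refine Real.log_le_log ?_ (ENNReal.toReal_le_of_le_ofReal (by positivity) (hup n hn))
    exact (by positivity : (0 : ℝ) < κ * T n).trans_le
      ((ENNReal.ofReal_le_iff_le_toReal hne).1 (hlow n (by omega)))

/-- A positive monotone function that is regularly varying of index `ρ` is `t ^ ρ` times a slowly
varying function, up to a constant factor. -/
theorem slowlyVarying_mul_div_rpow {T : ℝ → ℝ} (hT : Monotone T) (hpos : ∀ s, 0 < s → 0 < T s)
    {ρ K : ℝ} (hK : 0 < K)
    (h : ∀ x, 0 < x → Tendsto (fun s => T (s * x) / T s) atTop (𝓝 (x ^ ρ))) :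
    SlowlyVarying fun t => K * T t / t ^ ρ where
  measurable := (hT.measurable.const_mul K).div (measurable_id.pow_const ρ)
  pos t ht := by
    have := hpos t ht
    positivity
  tendsto x hx := by
    have hxρ : x ^ ρ ≠ 0 := (Real.rpow_pos_of_pos hx ρ).ne'
    have h1 := (h x hx).mul_const (x ^ ρ)⁻¹
    rw [mul_inv_cancel₀ hxρ] at h1
    refine h1.congr' ?_
    filter_upwards [eventually_gt_atTop 0] with t ht
    have h2 := (hpos t ht).ne'
    have h3 := (Real.rpow_pos_of_pos ht ρ).ne'
    rw [Real.mul_rpow ht.le hx.le]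
    field_simp

end EtacCode

theorem mainTheorem2 (f : ℕ+ → ℝ) (F : ℝ → ℝ) (γ : ℝ)
    (hf : EtacCode.IsEnvelope f)
    (hmono : EtacCode.UltimatelyNonincreasing f)
    (hF : EtacCode.IsSmoothedEnvelopeCDF f F)
    (hγ : 0 < γ)
    (hMDA : EtacCode.InMDA γ F) :
    (∃ (L : ℝ → ℝ) (κ : ℝ) (ε : ℕ → ℝ),
      EtacCode.SlowlyVarying L ∧ 0 < κ ∧ Tendsto ε atTop (𝓝 0) ∧
      (∀ n : ℕ, 1 ≤ n →
        ENNReal.ofReal (κ * L n * (n : ℝ) ^ (γ / (γ + 1)))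
            ≤ EtacCode.minimaxRedundancy n (EtacCode.envelopeClass f) ∧
        EtacCode.minimaxRedundancy n (EtacCode.envelopeClass f)
            ≤ EtacCode.maximalRedundancy (EtacCode.etac n) (EtacCode.envelopeClass f)) ∧
      ∀ᶠ n : ℕ in atTop,
        EtacCode.maximalRedundancy (EtacCode.etac n) (EtacCode.envelopeClass f)
          ≤ ENNReal.ofReal
              ((5 / 2 + ε n) * Real.logb 2 n * (L n * (n : ℝ) ^ (γ / (γ + 1))))) ∧
    Tendsto (fun n : ℕ =>
        Real.log (EtacCode.minimaxRedundancy n (EtacCode.envelopeClass f)).toReal / Real.log n)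
      atTop (𝓝 (γ / (γ + 1))) ∧
    Tendsto (fun n : ℕ =>
        Real.log (EtacCode.maximalRedundancy (EtacCode.etac n)
          (EtacCode.envelopeClass f)).toReal / Real.log n)
      atTop (𝓝 (γ / (γ + 1))) := by
  have hα : 0 < 1 / γ := by positivity
  have hRV := fun y hy => EtacCode.realTail_regularlyVarying hf hF hγ hMDA (y := y) hy
  have hG := EtacCode.realTail_antitone hf
  have hGpos := EtacCode.realTail_pos hf
  have hρ : 1 / (1 + 1 / γ) = γ / (γ + 1) := by field_simp
  set ρ := γ / (γ + 1)
  set T := EtacCode.effectiveSize (EtacCode.realTail f)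
  have hTmono : Monotone T := EtacCode.effectiveSize_mono hG hGpos
  have hTpos : ∀ s, 0 < s → 0 < T s := fun s hs => EtacCode.effectiveSize_pos hG hGpos hs
  have hTRV : ∀ x, 0 < x → Tendsto (fun s => T (s * x) / T s) atTop (𝓝 (x ^ ρ)) := fun x hx => by
    rw [← hρ]
    exact EtacCode.effectiveSize_regularlyVarying hG hGpos hα hRV hx
  have hTn : ∀ n : ℕ, 1 ≤ n → 0 < T n := fun n hn => hTpos _ (by exact_mod_cast hn)
  obtain ⟨κ, hκ, hlow⟩ :=
    EtacCode.exists_mul_effectiveSize_le_minimaxRedundancy hf hmono hα hRV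
  obtain ⟨K, hK, hup⟩ := EtacCode.exists_maximalRedundancy_etac_le hf hmono hα hRV
  have hminmax : ∀ n, EtacCode.minimaxRedundancy n (EtacCode.envelopeClass f)
      ≤ EtacCode.maximalRedundancy (EtacCode.etac n) (EtacCode.envelopeClass f) :=
    fun n => iInf_le _ _
  have hlim := EtacCode.tendsto_log_div_log hTmono hTpos (hTRV 2 two_pos)
  have hL : ∀ n : ℕ, 1 ≤ n → 2 / 5 * K * T n / (n : ℝ) ^ ρ * (n : ℝ) ^ ρ = 2 / 5 * K * T n :=
    fun n hn => div_mul_cancel₀ _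
      (Real.rpow_pos_of_pos (by exact_mod_cast hn : (0 : ℝ) < n) ρ).ne'
  -- the factor `2 / 5 * K` in `L` turns the constant `K` of the upper bound into `5 / 2`
  refine ⟨⟨fun t => 2 / 5 * K * T t / t ^ ρ, κ / (2 / 5 * K), fun _ => 0,
    EtacCode.slowlyVarying_mul_div_rpow hTmono hTpos (by positivity) hTRV, by positivity,
    tendsto_const_nhds, fun n hn => ⟨?_, hminmax n⟩, ?_⟩, ?_, ?_⟩
  · refine le_trans (ENNReal.ofReal_le_ofReal (le_of_eq ?_)) (hlow n hn)
    rw [mul_assoc, hL n hn, ← mul_assoc, div_mul_cancel₀ _ (by positivity)]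
  · filter_upwards [eventually_ge_atTop 2] with n hn
    refine (hup n hn).trans (ENNReal.ofReal_le_ofReal (le_of_eq ?_))
    rw [hL n (by omega)]
    ring
  · exact EtacCode.tendsto_log_toReal_div_log hκ hK hTn hlim hlow
      fun n hn => (hminmax n).trans (hup n hn)
  · exact EtacCode.tendsto_log_toReal_div_log hκ hK hTn hlim
      (fun n hn => (hlow n hn).trans (hminmax n)) hup
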